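/- Let $m\ge 1$ be an integer. Write points of $\mathbb{R}^{2m}$ as $\vec{\bm x}=(\bm x_1,\dots,\bm x_m)$ with $\bm x_j=(x_j,y_j)\in\mathbb{R}^2$, and put $Q_1(x,y)=\tfrac12(x^2-y^2)$, $B_1((x,y),(x',y'))=xx'-yy'$, $Q_m(\vec{\bm x})=\sum_{j}Q_1(\bm x_j)$, $B_m(\vec{\bm x},\vec{\bm x}')=\sum_j B_1(\bm x_j,\bm x'_j)$. Let $\mathcal{C}=\{(x,y)\in\mathbb{R}^2 : Q_1(x,y)<0,\ y>0\}$ and $E(z)=2\int_0^z e^{-\pi u^2}\,du$. For $\bm c=(c_1,c_2)\in\mathcal{C}$ put $\partial_{\bm c}(\bm x_j)=\frac{1}{\sqrt{-Q_1(\bm c)}}\left(c_1\frac{\partial}{\partial x_j}+c_2\frac{\partial}{\partial y_j}\right)$. For $\vec{\bm c}_0=(\bm c^{(0)}_1,\dots,\bm c^{(0)}_m)$, $\vec{\bm c}_1=(\bm c^{(1)}_1,\dots,\bm c^{(1)}_m)\in\mathcal{C}^m$ and a polynomial $f(\vec{\bm x})$ with complex coefficients of degree $d$ put $$p^{\vec{\bm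 c}_0,\vec{\bm c}_1}[f](\vec{\bm x})=\sum_{\sigma\in\{0,1\}^m}(-1)^{\sigma_1+\cdots+\sigma_m}\sum_{k=0}^{d}\frac{(-1)^k}{(4\pi)^k}\sum_{\substack{(k_1,\dots,k_m)\in(\mathbb{Z}_{\ge0})^m\\ k_1+\cdots+k_m=k}}\ \prod_{j=1}^m\frac{1}{k_j!}E^{(k_j)}\!\left(\frac{B_1(\bm c_j^{(\sigma_j)},\bm x_j)}{\sqrt{-Q_1(\bm c_j^{(\sigma_j)})}}\right)\cdot\left(\prod_{j=1}^m\partial_{\bm c_j^{(\sigma_j)}}(\bm x_j)^{k_j}\right)f(\vec{\bm x}).$$ For $\vec{\bm a},\vec{\bm b}\in\mathbb{R}^{2m}$, $\tau=u+iv$ with $v>0$, and $q^r=e^{2\pi i\tau r}$, put $$\theta_{\vec{\bm a},\vec{\bm b}}^{\vec{\bm c}_0,\vec{\bm c}_1}[f](\tau)=v^{-d/2}\sum_{\vec{\bm x}\in\vec{\bm a}+\mathbb{Z}^{2m}}p^{\vec{\bm c}_0,\vec{\bm c}_1}[f](\vec{\bm x}\sqrt v)\,q^{Q_m(\vec{\bm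 x})}e^{2\pi iB_m(\vec{\bm x},\vec{\bm b})}.$$ A polynomial $f$ is called spherical of degree $d$ if it is homogeneous of degree $d$ and $\sum_{j=1}^m\left(\frac{\partial^2}{\partial x_j^2}-\frac{\partial^2}{\partial y_j^2}\right)f=0$. Finally let $\operatorname{sgn}(0)=0$, $$V_m(\vec{\bm x})=\prod_{1\le i<j\le m}(x_i^2-x_j^2)(y_i^2-y_j^2)\prod_{j=1}^m x_jy_j,$$ $$\mathrm{KW}_m(\tau)=\frac{1}{4^m\,m!\left(\prod_{j=1}^m(2j-1)!\right)^2}\sum_{\substack{x_1,\dots,x_m\in\mathbb{Z}\\ y_1,\dots,y_m\in\frac12+\mathbb{Z}}}\ \prod_{j=1}^m\bigl(\operatorname{sgn}(x_j-y_j)-\operatorname{sgn}(-x_j-y_j)\bigr)\,V_m(\vec{\bm x})\prod_{j=1}^m q^{\frac12(x_j^2-y_j^2)}(-1)^{x_j-y_j-1/2}.$$ **Theorem.** For $t>0$ let $\vec{\bm c}_0(t)$ and $\vec{\bm c}_1(t)$ be the vectors all of whose components are $(1,1+t)$ and $(-1,1+t)$, respectively; they lie in $\mathcal{C}^m$. Let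 $\operatorname{Im}\tau>0$. (i) Let $f$ be a spherical polynomial, let $\vec{\bm a}\in\mathbb{R}^{2m}$ satisfy $B_1((1,1),\bm a_j)\notin\mathbb{Z}$ and $B_1((-1,1),\bm a_j)\notin\mathbb{Z}$ for all $1\le j\le m$, and let $\vec{\bm b}\in\mathbb{R}^{2m}$. Then $$\lim_{t\to0^+}\theta_{\vec{\bm a},\vec{\bm b}}^{\vec{\bm c}_0(t),\vec{\bm c}_1(t)}[f](\tau)=\sum_{\vec{\bm x}\in\vec{\bm a}+\mathbb{Z}^{2m}}\ \prod_{j=1}^m\bigl(\operatorname{sgn}(x_j-y_j)-\operatorname{sgn}(-x_j-y_j)\bigr)\,f(\vec{\bm x})\,q^{Q_m(\vec{\bm x})}e^{2\pi iB_m(\vec{\bm x},\vec{\bm b})}.$$ (ii) In particular, if all components of $\vec{\bm a}$ are $(0,\tfrac12)$, all components of $\vec{\bm b}$ are $(\tfrac12,\tfrac12)$, and $f=V_m$, then $$\lim_{t\to0^+}\theta_{\vec{\bm a},\vec{\bm b}}^{\vec{\bm c}_0(t),\vec{\bm c}_1(t)}[V_m](\tau)=(4i)^m\,m!\left(\prod_{j=1}^m(2j-1)!\right)^2\mathrm{KW}_m(\tau).$$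 All the series above (the theta series for every $t>0$, the sign-weighted series in (i), and the series defining $\mathrm{KW}_m(\tau)$) converge absolutely. -/

import Mathlib

noncomputable section

namespace KWTheta

/-- A point `(𝐱₁, …, 𝐱ₘ)` of `ℝ^{2m}`, where `𝐱ⱼ = (xⱼ, yⱼ)`. -/
abbrev Vec (m : ℕ) : Type := Fin m → ℝ × ℝ

/-- Polynomials in `x₁, …, xₘ` (indices `Sum.inl j`) and `y₁, …, yₘ` (indices `Sum.inr j`). -/
abbrev Poly (m : ℕ) : Type := MvPolynomial (Fin m ⊕ Fin m) ℂ

/-- The value `f(𝐱)` of a polynomial at a real point. -/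
def evalAt {m : ℕ} (f : Poly m) (x : Vec m) : ℂ :=
  MvPolynomial.eval (Sum.elim (fun j => ((x j).1 : ℂ)) (fun j => ((x j).2 : ℂ))) f

/-- `Q₁(x, y) = (x² - y²) / 2`. -/
def Q₁ (x : ℝ × ℝ) : ℝ := (x.1 ^ 2 - x.2 ^ 2) / 2

/-- `B₁((x, y), (x', y')) = x x' - y y'`. -/
def B₁ (x x' : ℝ × ℝ) : ℝ := x.1 * x'.1 - x.2 * x'.2

def Q {m : ℕ} (x : Vec m) : ℝ := ∑ j, Q₁ (x j)

def B {m : ℕ} (x x' : Vec m) : ℝ := ∑ j, B₁ (x j) (x' j)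

/-- The component `y > 0` of the set of negative vectors of `Q₁`. -/
def cone : Set (ℝ × ℝ) := {x | Q₁ x < 0 ∧ 0 < x.2}

/-- The error function `E(z) = 2 ∫₀^z e^{-π u²} du`. -/
def E (z : ℝ) : ℝ := 2 * ∫ u in (0 : ℝ)..z, Real.exp (-Real.pi * u ^ 2)

/-- The operator `∂_c(𝐱ⱼ) = (-Q₁(c))^{-1/2} (c₁ ∂/∂xⱼ + c₂ ∂/∂yⱼ)` on polynomials. -/
def dirDeriv {m : ℕ} (c : ℝ × ℝ) (j : Fin m) : Module.End ℂ (Poly m) :=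
  ((1 / √(-Q₁ c) : ℝ) : ℂ) •
    ((c.1 : ℂ) • (MvPolynomial.pderiv (R := ℂ) (Sum.inl j : Fin m ⊕ Fin m)).toLinearMap +
      (c.2 : ℂ) • (MvPolynomial.pderiv (R := ℂ) (Sum.inr j : Fin m ⊕ Fin m)).toLinearMap)

/-- `F_{σ,k}(𝐱)`, for vectors `c = (c₁^{(σ₁)}, …, cₘ^{(σₘ)})`. -/
def F {m : ℕ} (c : Vec m) (k : Fin m → ℕ) (x : Vec m) : ℝ :=
  ∏ j, 1 / ((k j).factorial : ℝ) * iteratedDeriv (k j) E (B₁ (c j) (x j) / √(-Q₁ (c j)))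

/-- `G_{σ,k}`, for vectors `c = (c₁^{(σ₁)}, …, cₘ^{(σₘ)})`: the composition over `j` of the
(commuting) operators `∂_{cⱼ}(𝐱ⱼ)^{kⱼ}`, applied to `f`. -/
def G {m : ℕ} (c : Vec m) (k : Fin m → ℕ) (f : Poly m) : Poly m :=
  (List.ofFn fun j => dirDeriv (c j) j ^ k j).prod f

/-- The function `p^{c₀,c₁}[f](𝐱)`; `Finset.piAntidiag Finset.univ k` is the set of all
`κ : Fin m → ℕ` with `κ₁ + ⋯ + κₘ = k`. -/
def p {m : ℕ} (c₀ c₁ : Vec m) (f : Poly m) (x : Vec m) : ℂ :=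
  ∑ σ : Fin m → Fin 2, (-1 : ℂ) ^ (∑ j, (σ j : ℕ)) *
    ∑ k ∈ Finset.range (f.totalDegree + 1), (-1 : ℂ) ^ k / (4 * (Real.pi : ℂ)) ^ k *
      ∑ κ ∈ Finset.piAntidiag (Finset.univ : Finset (Fin m)) k,
        (F (fun j => ![c₀ j, c₁ j] (σ j)) κ x : ℂ) *
          evalAt (G (fun j => ![c₀ j, c₁ j] (σ j)) κ f) x

/-- The Laplace operator `Δₘ = ∑ⱼ (∂²/∂xⱼ² - ∂²/∂yⱼ²)`. -/
def laplacian {m : ℕ} (f : Poly m) : Poly m :=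
  ∑ j : Fin m,
    (MvPolynomial.pderiv (Sum.inl j) (MvPolynomial.pderiv (Sum.inl j) f) -
      MvPolynomial.pderiv (Sum.inr j) (MvPolynomial.pderiv (Sum.inr j) f))

/-- Spherical polynomials of degree `d`. -/
def IsSpherical {m : ℕ} (f : Poly m) (d : ℕ) : Prop :=
  f.IsHomogeneous d ∧ laplacian f = 0

/-- The point `a + n` of the shifted lattice `a + ℤ^{2m}`. -/
def shift {m : ℕ} (a : Vec m) (n : Fin m → ℤ × ℤ) : Vec m :=
  fun j => ((a j).1 + ((n j).1 : ℝ), (a j).2 + ((n j).2 : ℝ))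

/-- `q^r = e^{2πiτr}` for real `r`. -/
def qPow (τ : UpperHalfPlane) (r : ℝ) : ℂ :=
  Complex.exp (2 * (Real.pi : ℂ) * Complex.I * (τ : ℂ) * (r : ℂ))

/-- `e^{2πir}` for real `r`. -/
def e (r : ℝ) : ℂ := Complex.exp (2 * (Real.pi : ℂ) * Complex.I * (r : ℂ))

/-- The summand of the theta function at a point `𝐱` of `a + ℤ^{2m}`. -/
def thetaTerm {m : ℕ} (c₀ c₁ b : Vec m) (f : Poly m) (τ : UpperHalfPlane) (x : Vec m) : ℂ :=
  p c₀ c₁ f (√τ.im • x) * qPow τ (Q x) * e (B x b)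

/-- The theta function `θ_{a,b}^{c₀,c₁}[f](τ)`; the weight factor is `v^{-d/2}`, `d = deg f`. -/
def theta {m : ℕ} (c₀ c₁ a b : Vec m) (f : Poly m) (τ : UpperHalfPlane) : ℂ :=
  ((τ.im ^ (-(f.totalDegree : ℝ) / 2) : ℝ) : ℂ) *
    ∑' n : Fin m → ℤ × ℤ, thetaTerm c₀ c₁ b f τ (shift a n)

/-- `∏ⱼ (sgn(xⱼ - yⱼ) - sgn(-xⱼ - yⱼ))`. -/
def signWeight {m : ℕ} (x : Vec m) : ℝ :=
  ∏ j, (Real.sign ((x j).1 - (x j).2) - Real.sign (-(x j).1 - (x j).2))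

/-- The summand of the sign-weighted series at a point `𝐱` of `a + ℤ^{2m}`. -/
def signTerm {m : ℕ} (b : Vec m) (f : Poly m) (τ : UpperHalfPlane) (x : Vec m) : ℂ :=
  (signWeight x : ℂ) * evalAt f x * qPow τ (Q x) * e (B x b)

/-- `c₀(t)`, all of whose components are `(1, 1 + t)`. -/
def c₀ (m : ℕ) (t : ℝ) : Vec m := fun _ => (1, 1 + t)

/-- `c₁(t)`, all of whose components are `(-1, 1 + t)`. -/
def c₁ (m : ℕ) (t : ℝ) : Vec m := fun _ => (-1, 1 + t)

/-- `Vₘ = ∏_{i<j} (xᵢ² - xⱼ²)(yᵢ² - yⱼ²) ∏ⱼ xⱼ yⱼ`. -/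
def V (m : ℕ) : Poly m :=
  (∏ i : Fin m, ∏ j ∈ Finset.Ioi i,
      ((MvPolynomial.X (Sum.inl i) ^ 2 - MvPolynomial.X (Sum.inl j) ^ 2) *
        (MvPolynomial.X (Sum.inr i) ^ 2 - MvPolynomial.X (Sum.inr j) ^ 2))) *
    ∏ j : Fin m, MvPolynomial.X (Sum.inl j) * MvPolynomial.X (Sum.inr j)

/-- The constant `m! (∏_{j=1}^m (2j-1)!)²`. -/
def kwConst (m : ℕ) : ℂ :=
  (m.factorial : ℂ) * (∏ j ∈ Finset.Icc 1 m, ((2 * j - 1).factorial : ℂ)) ^ 2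

/-- The point with `xⱼ = (n j).1 ∈ ℤ` and `yⱼ = 1/2 + (n j).2 ∈ 1/2 + ℤ`. -/
def kwPoint {m : ℕ} (n : Fin m → ℤ × ℤ) : Vec m :=
  fun j => (((n j).1 : ℝ), 1 / 2 + ((n j).2 : ℝ))

/-- The summand of the Kac-Wakimoto series. With `xⱼ = (n j).1` and `yⱼ = 1/2 + (n j).2`, the
integer `xⱼ - yⱼ - 1/2` is `(n j).1 - (n j).2 - 1`. -/
def kwTerm {m : ℕ} (τ : UpperHalfPlane) (n : Fin m → ℤ × ℤ) : ℂ :=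
  (signWeight (kwPoint n) : ℂ) * evalAt (V m) (kwPoint n) *
    ∏ j, (qPow τ (((kwPoint n j).1 ^ 2 - (kwPoint n j).2 ^ 2) / 2) *
      (-1 : ℂ) ^ ((n j).1 - (n j).2 - 1))

/-- The Kac-Wakimoto series `KWₘ(τ)`. -/
def KW (m : ℕ) (τ : UpperHalfPlane) : ℂ :=
  1 / 4 ^ m * (1 / kwConst m) * ∑' n : Fin m → ℤ × ℤ, kwTerm τ n

end KWTheta

end

/-!
Restricted to one monomial of `f`, the alternating sum defining `p` is a product over the `m`
planes, so the analysis takes place in a single plane. There `E^(k)` is its asymptotic value (`sgn`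
for `k = 0`, and `0` for `k > 0`) plus an error of Gaussian decay. With `s ^ 2 = t / (1 + t / 2)`,
the argument `z` of `E^(k)` for the vector `(1, 1 + t)` is `a - b`, where `a = (x - y) / s` and
`b = s (x + y) / 2`; since `Q₁ = a b`, the identity `z ^ 2 + 2 Q₁ = a ^ 2 + b ^ 2` shows that the
Gaussian overcomes the growth of `q ^ Q₁`, uniformly in `t`. As `a` is of size at least `1 / s` away
from the light cone, it also overcomes the powers of `1 / s` coming from the derivatives of `f`, and
the error vanishes as `s → 0`. The asymptotic values for the two vectors cancel where `Q₁ < 0`. The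
points of the shifted lattice stay away from the light cone, so the summands are dominated by
products of `exp (-ε ‖xⱼ‖)` and the limit may be taken termwise.
-/

noncomputable section

namespace KWTheta

open Asymptotics Filter Topology MeasureTheory

/-! ### Gaussian bounds and the error function -/

lemma one_add_pow_isBigO_exp (N : ℕ) {ε : ℝ} (hε : 0 < ε) :
    (fun w : ℝ => (1 + w) ^ N) =O[𝓟 (Set.Ici 0)] fun w => Real.exp (ε * w) := by
  refine isBigO_principal.2 ⟨N.factorial / ε ^ N * Real.exp ε, fun w (hw : 0 ≤ w) => ?_⟩
  have h := Real.pow_div_factorial_le_exp (ε * (1 + w)) (by positivity) N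
  rw [div_le_iff₀ (by positivity), mul_pow, mul_one_add, Real.exp_add] at h
  rw [Real.norm_of_nonneg (by positivity), Real.norm_of_nonneg (by positivity)]
  calc (1 + w) ^ N ≤ Real.exp ε * Real.exp (ε * w) * N.factorial / ε ^ N :=
        (le_div_iff₀' (by positivity)).2 h
    _ = _ := by ring

lemma pow_isBigO_exp_sq (n : ℕ) {ε : ℝ} (hε : 0 < ε) :
    (fun z : ℝ => z ^ n) =O[⊤] fun z => Real.exp (ε * z ^ 2) := by
  have h_sq : Tendsto (fun z : ℝ => z ^ 2) ⊤ (𝓟 (Set.Ici 0)) :=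
    tendsto_principal.2 (.of_forall fun z => sq_nonneg z)
  refine IsBigO.trans (.of_bound' (.of_forall fun z => ?_))
    ((one_add_pow_isBigO_exp n hε).comp_tendsto h_sq)
  have hz : |z| ≤ 1 + z ^ 2 := by nlinarith [sq_abs z, sq_nonneg (|z| - 1)]
  simpa [abs_of_nonneg (by positivity : 0 ≤ 1 + z ^ 2)] using
    pow_le_pow_left₀ (abs_nonneg z) hz n

lemma polynomial_isBigO_exp_sq (q : Polynomial ℝ) {ε : ℝ} (hε : 0 < ε) :
    (fun z => q.eval z) =O[⊤] fun z => Real.exp (ε * z ^ 2) := by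
  simp only [Polynomial.eval_eq_sum_range]
  exact .fun_sum fun n _ => (pow_isBigO_exp_sq n hε).const_mul_left _

lemma exists_iteratedDeriv_gaussian (b : ℝ) (k : ℕ) : ∃ q : Polynomial ℝ,
    iteratedDeriv k (fun z : ℝ => Real.exp (-b * z ^ 2)) =
      fun z => q.eval z * Real.exp (-b * z ^ 2) := by
  induction k with
  | zero => exact ⟨1, by simp⟩
  | succ k ih =>
    obtain ⟨q, hq⟩ := ih
    refine ⟨q.derivative - Polynomial.C (2 * b) * Polynomial.X * q, funext fun z => ?_⟩
    have hexp : HasDerivAt (fun z : ℝ => Real.exp (-b * z ^ 2))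
        (Real.exp (-b * z ^ 2) * (-b * (2 * z))) z := by
      simpa using (((hasDerivAt_id z).pow 2).const_mul (-b)).exp
    rw [iteratedDeriv_succ, hq, ((q.hasDerivAt z).fun_mul hexp).deriv]
    simp only [Polynomial.eval_sub, Polynomial.eval_mul, Polynomial.eval_C, Polynomial.eval_X]
    ring

lemma integral_Ioi_gaussian_le {b z : ℝ} (hb : 0 < b) (hz : 0 ≤ z) :
    ∫ u in Set.Ioi z, Real.exp (-b * u ^ 2) ≤ Real.exp (-b * z ^ 2) * (√(Real.pi / b) / 2) := by
  have hint : Integrable fun u : ℝ => Real.exp (-b * u ^ 2) := integrable_exp_neg_mul_sq hb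
  have hshift : ∫ u in Set.Ioi z, Real.exp (-b * u ^ 2) =
      ∫ u in Set.Ioi (0 : ℝ), Real.exp (-b * (u + z) ^ 2) := by
    rw [← (measurePreserving_add_right volume z).setIntegral_preimage_emb
      (measurableEmbedding_addRight z), Set.preimage_add_const_Ioi, sub_self]
  rw [hshift, ← integral_gaussian_Ioi, ← integral_const_mul]
  refine setIntegral_mono_on (hint.comp_add_right z).integrableOn
    (hint.const_mul _).integrableOn measurableSet_Ioi fun u (hu : 0 < u) => ?_
  rw [← Real.exp_add, Real.exp_le_exp]
  nlinarith [mul_nonneg hb.le (mul_nonneg hu.le hz)]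

lemma hasDerivAt_E (z : ℝ) : HasDerivAt E (2 * Real.exp (-Real.pi * z ^ 2)) z := by
  have hc : Continuous fun u : ℝ => Real.exp (-Real.pi * u ^ 2) := by fun_prop
  exact (intervalIntegral.integral_hasDerivAt_right (hc.intervalIntegrable _ _)
    (hc.stronglyMeasurableAtFilter _ _) hc.continuousAt).const_mul 2

lemma E_neg (z : ℝ) : E (-z) = -E z := by
  have h := intervalIntegral.integral_comp_neg (a := 0) (b := z)
    (fun u : ℝ => Real.exp (-Real.pi * u ^ 2))
  simp only [neg_sq, neg_zero] at h
  rw [E, E, intervalIntegral.integral_symm, ← h]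
  ring

lemma one_sub_E_eq {z : ℝ} (hz : 0 ≤ z) :
    1 - E z = 2 * ∫ u in Set.Ioi z, Real.exp (-Real.pi * u ^ 2) := by
  have h := intervalIntegral.integral_Ioi_sub_Ioi (a := 0) (b := z)
    (integrable_exp_neg_mul_sq Real.pi_pos).integrableOn hz
  rw [integral_gaussian_Ioi, div_self Real.pi_pos.ne', Real.sqrt_one] at h
  rw [E, ← h]
  ring

lemma abs_one_sub_E_le {z : ℝ} (hz : 0 ≤ z) : |1 - E z| ≤ Real.exp (-Real.pi * z ^ 2) := by
  have h := integral_Ioi_gaussian_le Real.pi_pos hz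
  rw [div_self Real.pi_pos.ne', Real.sqrt_one] at h
  rw [one_sub_E_eq hz, abs_of_nonneg (by positivity)]
  linarith

lemma abs_E_sub_sign_le (z : ℝ) : |E z - Real.sign z| ≤ Real.exp (-Real.pi * z ^ 2) := by
  rcases lt_trichotomy z 0 with hz | rfl | hz
  · have h := abs_one_sub_E_le (neg_nonneg.2 hz.le)
    rwa [E_neg, neg_sq, sub_neg_eq_add, add_comm, ← sub_neg_eq_add, ← Real.sign_of_neg hz] at h
  · simp [E]
  · rw [abs_sub_comm, Real.sign_of_pos hz]
    exact abs_one_sub_E_le hz.le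

/-- The asymptotic value of `E^{(k)}` at infinity, on the half-line of `z`. -/
def asympE (k : ℕ) (z : ℝ) : ℝ := if k = 0 then Real.sign z else 0

/-- The error `E^{(k)} - asympE k`, a function of Gaussian decay. -/
def remE (k : ℕ) (z : ℝ) : ℝ := iteratedDeriv k E z - asympE k z

lemma exists_remE_succ_eq (k : ℕ) : ∃ q : Polynomial ℝ, ∀ z,
    remE (k + 1) z = q.eval z * Real.exp (-Real.pi * z ^ 2) := by
  obtain ⟨q, hq⟩ := exists_iteratedDeriv_gaussian Real.pi k
  refine ⟨Polynomial.C 2 * q, fun z => ?_⟩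
  rw [remE, asympE, if_neg k.succ_ne_zero, sub_zero, iteratedDeriv_succ',
    funext fun z => (hasDerivAt_E z).deriv, iteratedDeriv_const_mul_field, hq]
  simp only [Polynomial.eval_mul, Polynomial.eval_C, mul_assoc]

lemma remE_isBigO_gaussian (k : ℕ) {a : ℝ} (ha : a < Real.pi) :
    remE k =O[⊤] fun z => Real.exp (-a * z ^ 2) := by
  cases k with
  | zero =>
    refine .of_bound' (.of_forall fun z => ?_)
    rw [remE, asympE, if_pos rfl, iteratedDeriv_zero, Real.norm_eq_abs, Real.norm_eq_abs,
      Real.abs_exp]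
    exact (abs_E_sub_sign_le z).trans (by gcongr)
  | succ k =>
    obtain ⟨q, hq⟩ := exists_remE_succ_eq k
    rw [funext hq]
    refine ((polynomial_isBigO_exp_sq q (sub_pos.2 ha)).mul (isBigO_refl _ _)).congr_right
      fun z => ?_
    rw [← Real.exp_add]
    ring_nf

/-! ### Derivatives along the cone vectors -/

lemma evalAt_add {m : ℕ} (f g : Poly m) (x : Vec m) : evalAt (f + g) x = evalAt f x + evalAt g x :=
  map_add _ f g

lemma evalAt_smul {m : ℕ} (a : ℂ) (f : Poly m) (x : Vec m) : evalAt (a • f) x = a * evalAt f x :=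
  MvPolynomial.smul_eval _ _ _

lemma evalAt_isBigO_one_add_norm_pow {m : ℕ} (f : Poly m) :
    evalAt f =O[⊤] fun x => (1 + ‖x‖) ^ f.totalDegree := by
  have hcoord (x : Vec m) (i : Fin m ⊕ Fin m) :
      ‖Sum.elim (fun j => ((x j).1 : ℂ)) (fun j => ((x j).2 : ℂ)) i‖ ≤ 1 + ‖x‖ := by
    rcases i with j | j <;> rw [← zero_add ‖Sum.elim _ _ _‖] <;>
      refine add_le_add zero_le_one (le_trans ?_ (norm_le_pi_norm x j))
    · simpa using norm_fst_le (x j)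
    · simpa using norm_snd_le (x j)
  have hmonomial (d : Fin m ⊕ Fin m →₀ ℕ) (hd : d ∈ f.support) :
      (fun x : Vec m => ∏ i, Sum.elim (fun j => ((x j).1 : ℂ)) (fun j => ((x j).2 : ℂ)) i ^ d i)
        =O[⊤] fun x => (1 + ‖x‖) ^ f.totalDegree := by
    refine .of_bound' (.of_forall fun x => ?_)
    rw [norm_prod, Real.norm_of_nonneg (by positivity)]
    calc ∏ i, ‖Sum.elim (fun j => ((x j).1 : ℂ)) (fun j => ((x j).2 : ℂ)) i ^ d i‖
        ≤ ∏ i, (1 + ‖x‖) ^ d i :=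
          Finset.prod_le_prod (fun _ _ => norm_nonneg _) fun i _ =>
            (norm_pow _ _).trans_le (pow_le_pow_left₀ (norm_nonneg _) (hcoord x i) _)
      _ = (1 + ‖x‖) ^ d.sum fun _ n => n := by
          rw [Finset.prod_pow_eq_pow_sum, Finsupp.sum_fintype _ _ fun _ => rfl]
      _ ≤ _ := pow_le_pow_right₀ (by simp) (MvPolynomial.le_totalDegree hd)
  have hsum : evalAt f = fun x => ∑ d ∈ f.support, f.coeff d *
      ∏ i, Sum.elim (fun j => ((x j).1 : ℂ)) (fun j => ((x j).2 : ℂ)) i ^ d i :=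
    funext fun x => MvPolynomial.eval_eq' _ _
  rw [hsum]
  exact .fun_sum fun d hd => (hmonomial d hd).const_mul_left _

lemma dirDeriv_apply {m : ℕ} (c : ℝ × ℝ) (j : Fin m) (f : Poly m) :
    dirDeriv c j f = ((c.1 / √(-Q₁ c) : ℝ) : ℂ) • MvPolynomial.pderiv (Sum.inl j) f +
      ((c.2 / √(-Q₁ c) : ℝ) : ℂ) • MvPolynomial.pderiv (Sum.inr j) f := by
  simp only [dirDeriv, LinearMap.smul_apply, LinearMap.add_apply, Derivation.coeFn_coe, smul_add,
    smul_smul, ← Complex.ofReal_mul, one_div_mul_eq_div]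

lemma exists_evalAt_dirDeriv_pow_isBigO {ι : Type*} {l : Filter ι} {m : ℕ} {c : ι → ℝ × ℝ}
    {M : ι → ℝ} (h₁ : (fun i => (c i).1 / √(-Q₁ (c i))) =O[l] M)
    (h₂ : (fun i => (c i).2 / √(-Q₁ (c i))) =O[l] M) (j : Fin m) (x : ι → Vec m) (k : ℕ)
    (f : Poly m) :
    ∃ N : ℕ, (fun i => evalAt ((dirDeriv (c i) j ^ k) f) (x i)) =O[l]
      fun i => M i ^ k * (1 + ‖x i‖) ^ N := by
  induction k generalizing f with
  | zero =>
    exact ⟨f.totalDegree, by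
      simpa [Function.comp_def] using
        (evalAt_isBigO_one_add_norm_pow f).comp_tendsto (tendsto_top (f := x))⟩
  | succ k ih =>
    have hmono {N N' : ℕ} (h : N ≤ N') :
        (fun i => (1 + ‖x i‖) ^ N) =O[l] fun i => (1 + ‖x i‖) ^ N' :=
      .of_bound' (.of_forall fun i => by
        rw [Real.norm_of_nonneg (by positivity), Real.norm_of_nonneg (by positivity)]
        exact pow_le_pow_right₀ (by simp) h)
    obtain ⟨N₁, hN₁⟩ := ih (MvPolynomial.pderiv (Sum.inl j) f)
    obtain ⟨N₂, hN₂⟩ := ih (MvPolynomial.pderiv (Sum.inr j) f)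
    refine ⟨max N₁ N₂, ?_⟩
    simp only [pow_succ _ k, Module.End.mul_apply, dirDeriv_apply _ j f, map_add, map_smul,
      evalAt_add, evalAt_smul]
    have hx := (Complex.isBigO_ofReal_left.2 h₁).mul
      (hN₁.trans ((isBigO_refl _ _).mul (hmono (le_max_left N₁ N₂))))
    have hy := (Complex.isBigO_ofReal_left.2 h₂).mul
      (hN₂.trans ((isBigO_refl _ _).mul (hmono (le_max_right N₁ N₂))))
    exact (hx.add hy).congr_right fun i => by ring

/-- The parameter `s = √(t / (1 + t/2))`, for which `c₀(t) / √(-Q₁(c₀(t)))` equals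
`s⁻¹ (1, 1) + (s/2) (-1, 1)`, and similarly for `c₁(t)`. -/
def scale (t : ℝ) : ℝ := √(t / (1 + t / 2))

lemma scale_pos {t : ℝ} (ht : 0 < t) : 0 < scale t := Real.sqrt_pos.2 (by positivity)

lemma scale_sq {t : ℝ} (ht : 0 < t) : scale t ^ 2 = t / (1 + t / 2) :=
  Real.sq_sqrt (by positivity)

lemma scale_div_two_lt_inv {t : ℝ} (ht : 0 < t) : scale t / 2 < (scale t)⁻¹ := by
  rw [div_lt_iff₀ two_pos, ← div_eq_inv_mul, lt_div_iff₀ (scale_pos ht), ← sq, scale_sq ht,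
    div_lt_iff₀ (by positivity)]
  linarith

lemma tendsto_scale : Tendsto scale (𝓝[>] 0) (𝓝[>] 0) := by
  refine tendsto_nhdsWithin_iff.2 ⟨?_, eventually_mem_nhdsWithin.mono fun t ht => scale_pos ht⟩
  have h : ContinuousAt scale 0 :=
    (ContinuousAt.div (by fun_prop) (by fun_prop) (by norm_num)).sqrt
  simpa [scale] using h.tendsto.mono_left nhdsWithin_le_nhds

lemma sqrt_neg_Q₁ {u : ℝ} (hu : u ^ 2 = 1) {t : ℝ} (ht : 0 < t) :
    √(-Q₁ (u, 1 + t)) = scale t * (1 + t / 2) := by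
  have := scale_pos ht
  rw [Real.sqrt_eq_iff_mul_self_eq_of_pos (by positivity), ← sq, mul_pow, scale_sq ht, Q₁]
  field_simp
  linear_combination hu

lemma fst_div_sqrt_neg_Q₁ {u : ℝ} (hu : u ^ 2 = 1) {t : ℝ} (ht : 0 < t) :
    u / √(-Q₁ (u, 1 + t)) = u * ((scale t)⁻¹ - scale t / 2) := by
  have hs := scale_pos ht
  rw [sqrt_neg_Q₁ hu ht]
  field_simp
  rw [scale_sq ht]
  field_simp
  ring

lemma snd_div_sqrt_neg_Q₁ {u : ℝ} (hu : u ^ 2 = 1) {t : ℝ} (ht : 0 < t) :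
    (1 + t) / √(-Q₁ (u, 1 + t)) = (scale t)⁻¹ + scale t / 2 := by
  have hs := scale_pos ht
  rw [sqrt_neg_Q₁ hu ht]
  field_simp
  rw [scale_sq ht]
  field_simp
  ring

lemma fst_div_sqrt_neg_Q₁_isBigO {u : ℝ} (hu : u ^ 2 = 1) :
    (fun t => u / √(-Q₁ (u, 1 + t))) =O[𝓟 (Set.Ioi 0)] fun t => (scale t)⁻¹ := by
  refine isBigO_principal.2 ⟨1, fun t (ht : 0 < t) => ?_⟩
  have hs := scale_pos ht
  have hs' := scale_div_two_lt_inv ht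
  have habs : |u| = 1 := (abs_pow_eq_one u two_ne_zero).1 (by rw [hu, abs_one])
  rw [fst_div_sqrt_neg_Q₁ hu ht, norm_mul, Real.norm_eq_abs u, habs,
    Real.norm_of_nonneg (by linarith), Real.norm_of_nonneg (by positivity)]
  linarith

lemma snd_div_sqrt_neg_Q₁_isBigO {u : ℝ} (hu : u ^ 2 = 1) :
    (fun t => (1 + t) / √(-Q₁ (u, 1 + t))) =O[𝓟 (Set.Ioi 0)] fun t => (scale t)⁻¹ := by
  refine isBigO_principal.2 ⟨2, fun t (ht : 0 < t) => ?_⟩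
  have hs := scale_pos ht
  have hs' := scale_div_two_lt_inv ht
  rw [snd_div_sqrt_neg_Q₁ hu ht, Real.norm_of_nonneg (by positivity),
    Real.norm_of_nonneg (by positivity)]
  linarith

lemma B₁_div_sqrt_neg_Q₁ {u : ℝ} (hu : u ^ 2 = 1) {t : ℝ} (ht : 0 < t) (x : ℝ × ℝ) :
    B₁ (u, 1 + t) x / √(-Q₁ (u, 1 + t)) =
      (u * x.1 - x.2) / scale t - scale t * (u * x.1 + x.2) / 2 := by
  rw [B₁, sub_div, mul_div_right_comm, mul_div_right_comm, fst_div_sqrt_neg_Q₁ hu ht,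
    snd_div_sqrt_neg_Q₁ hu ht]
  ring

/-! ### The majorant of a plane -/

/-- The points of the plane at distance at least `δ` (up to a factor `√2`) from the light cone
`Q₁ = 0`. -/
def awayFromLightCone (δ : ℝ) : Set (ℝ × ℝ) := {x | δ ≤ |x.1 - x.2| ∧ δ ≤ |x.1 + x.2|}

/-- The positive function dominating the contribution of a plane to `p`. Its first factor
`e^{2πQ₁(x)}` cancels the growth of `|q^{Q₁(x)}|`. -/
def majorant (ε : ℝ) (x : ℝ × ℝ) : ℝ := Real.exp (2 * Real.pi * Q₁ x - ε * ‖x‖)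

lemma majorant_pos (ε : ℝ) (x : ℝ × ℝ) : 0 < majorant ε x := Real.exp_pos _

lemma majorant_mul_one_add_norm_pow_isBigO {ε ε' : ℝ} (h : ε' < ε) (N : ℕ) :
    (fun x => majorant ε x * (1 + ‖x‖) ^ N) =O[⊤] majorant ε' := by
  have hnorm : Tendsto (norm : ℝ × ℝ → ℝ) ⊤ (𝓟 (Set.Ici 0)) :=
    tendsto_principal.2 (.of_forall norm_nonneg)
  refine ((isBigO_refl (majorant ε) ⊤).mul
    ((one_add_pow_isBigO_exp N (sub_pos.2 h)).comp_tendsto hnorm)).congr_right fun x => ?_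
  rw [majorant, majorant, Function.comp_apply, ← Real.exp_add]
  ring_nf

lemma two_mul_Q₁_eq {u : ℝ} (hu : u ^ 2 = 1) (x : ℝ × ℝ) :
    2 * Q₁ x = (u * x.1 - x.2) * (u * x.1 + x.2) := by
  rw [Q₁]
  linear_combination -x.1 ^ 2 * hu

lemma mul_norm_le_two_mul_abs_Q₁ {δ : ℝ} {x : ℝ × ℝ} (hx : x ∈ awayFromLightCone δ) :
    δ * ‖x‖ ≤ 2 * |Q₁ x| := by
  have hnorm : ‖x‖ ≤ max |x.1 - x.2| |x.1 + x.2| := by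
    refine max_le ?_ ?_ <;> rw [Real.norm_eq_abs, abs_le', le_max_iff, le_max_iff] <;>
      grind
  calc δ * ‖x‖ ≤ min |x.1 - x.2| |x.1 + x.2| * ‖x‖ := by gcongr; exact le_min hx.1 hx.2
    _ ≤ min |x.1 - x.2| |x.1 + x.2| * max |x.1 - x.2| |x.1 + x.2| := by gcongr
    _ = 2 * |Q₁ x| := by
      rw [min_mul_max, ← abs_mul, ← abs_two (α := ℝ), ← abs_mul, two_mul_Q₁_eq (one_pow 2), one_mul]

lemma abs_sub_ge_of_mem_awayFromLightCone {u δ : ℝ} (hu : u ^ 2 = 1) {x : ℝ × ℝ}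
    (hx : x ∈ awayFromLightCone δ) : δ ≤ |u * x.1 - x.2| := by
  rcases sq_eq_one_iff.1 hu with rfl | rfl
  · simpa using hx.1
  · rw [neg_one_mul, ← neg_add', abs_neg]
    exact hx.2

/-- The Gaussian `exp (-π z²)` beats the growth `exp (-π p r)` of the `q`-power: with `a = p / s`
and `b = s r / 2` one has `z² + p r = (a - b)² + 2 a b = a² + b²`. -/
lemma gaussian_exponent_le {δ s p : ℝ} (hδ : 0 ≤ δ) (hs : 0 < s) (hp : δ ≤ |p|) (r : ℝ) :
    -(3 / 4 * Real.pi) * (p / s - s * r / 2) ^ 2 ≤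
      Real.pi * (p * r) - (δ * s⁻¹) ^ 2 / 2 - |p * r| / 2 := by
  obtain ⟨a, rfl⟩ : ∃ a, p = s * a := ⟨p / s, by field_simp⟩
  obtain ⟨b, rfl⟩ : ∃ b, r = 2 * b / s := ⟨s * r / 2, by field_simp⟩
  have ha : (δ * s⁻¹) ^ 2 ≤ a ^ 2 := by
    rw [abs_mul, abs_of_pos hs] at hp
    rw [← div_eq_mul_inv, sq_le_sq, abs_of_nonneg (by positivity), div_le_iff₀' hs]
    exact hp
  have hab : |2 * (a * b)| ≤ a ^ 2 + 2 * b ^ 2 := by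
    rw [abs_le]
    constructor <;> nlinarith [sq_nonneg (a + b), sq_nonneg (a - b), sq_nonneg b]
  have hz : s * a / s - s * (2 * b / s) / 2 = a - b := by field_simp
  have hpr : s * a * (2 * b / s) = 2 * (a * b) := by field_simp
  rw [hz, hpr]
  nlinarith [Real.pi_gt_three, sq_nonneg (a + b), sq_nonneg a, sq_nonneg b]

/-! ### The contribution of a single plane -/

/-- The factor of the summands of `p` that belongs to one plane `ℝ²`, for a vector `c` of the cone
and a polynomial `g` in the coordinates of that plane; `φ` stands for `E^{(k)}` or a part of it. -/
def planeTerm (φ : ℝ → ℝ) (k : ℕ) (g : Poly 1) (c x : ℝ × ℝ) : ℂ :=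
  ((1 / (k.factorial : ℝ) * φ (B₁ c x / √(-Q₁ c)) : ℝ) : ℂ) *
    evalAt ((dirDeriv c 0 ^ k) g) fun _ => x

/-- The alternating sum over `σⱼ ∈ {0, 1}` in `p`, restricted to one plane. -/
def planeFactor (k : ℕ) (g : Poly 1) (c c' x : ℝ × ℝ) : ℂ :=
  planeTerm (iteratedDeriv k E) k g c x - planeTerm (iteratedDeriv k E) k g c' x

lemma planeTerm_asympE (k : ℕ) (g : Poly 1) (c x : ℝ × ℝ) :
    planeTerm (asympE k) k g c x =
      (asympE k (B₁ c x / √(-Q₁ c)) : ℂ) * evalAt g fun _ => x := by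
  cases k with
  | zero => simp [planeTerm]
  | succ k => simp [planeTerm, asympE]

lemma planeFactor_eq (k : ℕ) (g : Poly 1) (c c' x : ℝ × ℝ) :
    planeFactor k g c c' x =
      ((asympE k (B₁ c x / √(-Q₁ c)) - asympE k (B₁ c' x / √(-Q₁ c')) : ℝ) : ℂ) *
        evalAt g (fun _ => x) +
      (planeTerm (remE k) k g c x - planeTerm (remE k) k g c' x) := by
  have hsplit (c : ℝ × ℝ) : planeTerm (iteratedDeriv k E) k g c x =
      planeTerm (asympE k) k g c x + planeTerm (remE k) k g c x := by
    simp only [planeTerm, remE]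
    push_cast
    ring
  rw [planeFactor, hsplit, hsplit, planeTerm_asympE, planeTerm_asympE]
  push_cast
  ring

lemma evalAt_const_isBigO (g : Poly 1) :
    (fun x : ℝ × ℝ => evalAt g fun _ => x) =O[⊤] fun x => (1 + ‖x‖) ^ g.totalDegree := by
  simpa only [Function.comp_def, pi_norm_const] using
    (evalAt_isBigO_one_add_norm_pow g).comp_tendsto
      (tendsto_top (f := fun (x : ℝ × ℝ) (_ : Fin 1) => x))

lemma remE_isBigO_majorant (k : ℕ) {u : ℝ} (hu : u ^ 2 = 1) {δ : ℝ} (hδ : 0 < δ) :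
    (fun z : ℝ × ℝ × ℝ => remE k (B₁ (u, 1 + z.1) z.2 / √(-Q₁ (u, 1 + z.1))))
      =O[𝓟 (Set.Ioi 0 ×ˢ awayFromLightCone δ)]
        fun z => Real.exp (-(δ ^ 2 / 2) * (scale z.1)⁻¹ ^ 2) * majorant (δ / 2) z.2 := by
  refine ((remE_isBigO_gaussian k (a := 3 / 4 * Real.pi)
    (by linarith [Real.pi_pos])).comp_tendsto tendsto_top).trans
      (.of_bound' (eventually_principal.2 ?_))
  rintro ⟨t, x⟩ ⟨ht, hx⟩
  have hexp := gaussian_exponent_le hδ.le (scale_pos ht)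
    (abs_sub_ge_of_mem_awayFromLightCone hu hx) (u * x.1 + x.2)
  rw [← two_mul_Q₁_eq hu, abs_mul, abs_two] at hexp
  have hQ := mul_norm_le_two_mul_abs_Q₁ hx
  rw [Function.comp_apply, majorant, ← Real.exp_add, Real.norm_eq_abs, Real.norm_eq_abs,
    Real.abs_exp, Real.abs_exp, Real.exp_le_exp, B₁_div_sqrt_neg_Q₁ hu ht]
  linear_combination hexp + hQ / 2

lemma planeTerm_remE_isBigO (k : ℕ) (g : Poly 1) {u : ℝ} (hu : u ^ 2 = 1) {δ : ℝ} (hδ : 0 < δ) :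
    (fun z : ℝ × ℝ × ℝ => planeTerm (remE k) k g (u, 1 + z.1) z.2)
      =O[𝓟 (Set.Ioi 0 ×ˢ awayFromLightCone δ)] fun z => scale z.1 * majorant (δ / 4) z.2 := by
  have hfst : Tendsto Prod.fst (𝓟 (Set.Ioi 0 ×ˢ awayFromLightCone δ)) (𝓟 (Set.Ioi (0 : ℝ))) :=
    tendsto_principal_principal.2 fun z hz => hz.1
  obtain ⟨N, hN⟩ := exists_evalAt_dirDeriv_pow_isBigO (c := fun z : ℝ × ℝ × ℝ => (u, 1 + z.1))
    ((fst_div_sqrt_neg_Q₁_isBigO hu).comp_tendsto hfst)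
    ((snd_div_sqrt_neg_Q₁_isBigO hu).comp_tendsto hfst) 0 (fun z _ => z.2) k g
  have hprod := (Complex.isBigO_ofReal_left.2
    ((remE_isBigO_majorant k hu hδ).const_mul_left (1 / (k.factorial : ℝ)))).mul hN
  have hpow : (fun z : ℝ × ℝ × ℝ => (scale z.1)⁻¹ ^ (k + 1))
      =O[𝓟 (Set.Ioi 0 ×ˢ awayFromLightCone δ)]
        fun z => Real.exp (δ ^ 2 / 2 * (scale z.1)⁻¹ ^ 2) :=
    (pow_isBigO_exp_sq (k + 1) (by positivity)).comp_tendsto tendsto_top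
  have hx : (fun z : ℝ × ℝ × ℝ => majorant (δ / 2) z.2 * (1 + ‖z.2‖) ^ N)
      =O[𝓟 (Set.Ioi 0 ×ˢ awayFromLightCone δ)] fun z => majorant (δ / 4) z.2 :=
    (majorant_mul_one_add_norm_pow_isBigO (by linarith) N).comp_tendsto tendsto_top
  refine hprod.trans ((((isBigO_refl (fun z : ℝ × ℝ × ℝ => scale z.1 *
    Real.exp (-(δ ^ 2 / 2) * (scale z.1)⁻¹ ^ 2)) _).mul hpow).mul hx).congr' ?_ ?_) <;>
    refine eventually_principal.2 fun z hz => ?_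
  · have := (scale_pos hz.1).ne'
    simp only [pi_norm_const, Function.comp_apply, pow_succ _ k]
    field_simp
  · simp only [neg_mul, Real.exp_neg]
    field_simp

lemma sign_div_sub_mul_of_mul_neg {s p r : ℝ} (hs : 0 < s) (h : p * r < 0) :
    Real.sign (p / s - s * r / 2) = Real.sign p := by
  rcases mul_neg_iff.1 h with ⟨hp, hr⟩ | ⟨hp, hr⟩
  · rw [Real.sign_of_pos hp, Real.sign_of_pos]
    linarith [div_pos hp hs, mul_neg_of_pos_of_neg hs hr]
  · rw [Real.sign_of_neg hp, Real.sign_of_neg]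
    linarith [div_neg_of_neg_of_pos hp hs, mul_pos hs hr]

lemma sign_eq_sign_of_mul_pos {a b : ℝ} (h : 0 < a * b) : Real.sign a = Real.sign b := by
  rcases pos_and_pos_or_neg_and_neg_of_mul_pos h with ⟨ha, hb⟩ | ⟨ha, hb⟩
  · rw [Real.sign_of_pos ha, Real.sign_of_pos hb]
  · rw [Real.sign_of_neg ha, Real.sign_of_neg hb]

lemma abs_asympE_le_one (k : ℕ) (z : ℝ) : |asympE k z| ≤ 1 := by
  rw [asympE]
  split_ifs
  · rcases Real.sign_apply_eq z with h | h | h <;> simp [h]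
  · simp

lemma asympE_sub_asympE_eq_zero (k : ℕ) {t : ℝ} (ht : 0 < t) {x : ℝ × ℝ} (hx : Q₁ x < 0) :
    asympE k (B₁ (1, 1 + t) x / √(-Q₁ (1, 1 + t))) =
      asympE k (B₁ (-1, 1 + t) x / √(-Q₁ (-1, 1 + t))) := by
  have h₁ : (1 * x.1 - x.2) * (1 * x.1 + x.2) < 0 := by
    rw [← two_mul_Q₁_eq (one_pow 2)]
    linarith
  have h₂ : (-1 * x.1 - x.2) * (-1 * x.1 + x.2) < 0 := by
    rw [← two_mul_Q₁_eq neg_one_sq]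
    linarith
  rw [asympE, asympE, B₁_div_sqrt_neg_Q₁ (one_pow 2) ht, B₁_div_sqrt_neg_Q₁ neg_one_sq ht,
    sign_div_sub_mul_of_mul_neg (scale_pos ht) h₁, sign_div_sub_mul_of_mul_neg (scale_pos ht) h₂,
    sign_eq_sign_of_mul_pos (b := -1 * x.1 - x.2) (by linarith)]

lemma asympE_sub_asympE_isBigO (k : ℕ) (δ : ℝ) :
    (fun z : ℝ × ℝ × ℝ => asympE k (B₁ (1, 1 + z.1) z.2 / √(-Q₁ (1, 1 + z.1))) -
        asympE k (B₁ (-1, 1 + z.1) z.2 / √(-Q₁ (-1, 1 + z.1))))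
      =O[𝓟 (Set.Ioi 0 ×ˢ awayFromLightCone δ)] fun z => majorant δ z.2 := by
  refine isBigO_principal.2 ⟨2, ?_⟩
  rintro ⟨t, x⟩ ⟨ht, hx⟩
  rw [Real.norm_of_nonneg (majorant_pos δ x).le]
  rcases lt_or_ge (Q₁ x) 0 with hQ | hQ
  · rw [asympE_sub_asympE_eq_zero k ht hQ, sub_self, norm_zero]
    exact mul_nonneg two_pos.le (majorant_pos δ x).le
  · have hδ := mul_norm_le_two_mul_abs_Q₁ hx
    rw [abs_of_nonneg hQ] at hδ
    have hmaj : 1 ≤ majorant δ x := Real.one_le_exp (by nlinarith [Real.pi_gt_three])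
    refine (abs_sub _ _).trans ?_
    linarith [abs_asympE_le_one k (B₁ (1, 1 + t) x / √(-Q₁ (1, 1 + t))),
      abs_asympE_le_one k (B₁ (-1, 1 + t) x / √(-Q₁ (-1, 1 + t)))]

lemma scale_isBigO_one : scale =O[𝓟 (Set.Ioi 0)] fun _ => (1 : ℝ) := by
  refine isBigO_principal.2 ⟨2, fun t (ht : 0 < t) => ?_⟩
  have hs := scale_pos ht
  have h := scale_div_two_lt_inv ht
  rw [div_lt_iff₀ two_pos, ← div_eq_inv_mul, lt_div_iff₀ hs] at h
  rw [Real.norm_of_nonneg hs.le, norm_one]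
  nlinarith

lemma planeFactor_isBigO_majorant (k : ℕ) (g : Poly 1) {δ : ℝ} (hδ : 0 < δ) :
    (fun z : ℝ × ℝ × ℝ => planeFactor k g (1, 1 + z.1) (-1, 1 + z.1) z.2)
      =O[𝓟 (Set.Ioi 0 ×ˢ awayFromLightCone δ)] fun z => majorant (δ / 4) z.2 := by
  have hasymp := (Complex.isBigO_ofReal_left.2 (asympE_sub_asympE_isBigO k δ)).mul
    ((evalAt_const_isBigO g).comp_tendsto
      (tendsto_top (f := (Prod.snd : ℝ × ℝ × ℝ → ℝ × ℝ))))
  have hasymp' := hasymp.trans ((majorant_mul_one_add_norm_pow_isBigO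
    (by linarith : δ / 4 < δ) g.totalDegree).comp_tendsto tendsto_top)
  have hscale : (fun z : ℝ × ℝ × ℝ => scale z.1 * majorant (δ / 4) z.2)
      =O[𝓟 (Set.Ioi 0 ×ˢ awayFromLightCone δ)] fun z => majorant (δ / 4) z.2 := by
    simpa using (scale_isBigO_one.comp_tendsto (tendsto_principal_principal.2 fun z hz => hz.1)).mul
      (isBigO_refl (fun z : ℝ × ℝ × ℝ => majorant (δ / 4) z.2) _)
  have hrem {u : ℝ} (hu : u ^ 2 = 1) := (planeTerm_remE_isBigO k g hu hδ).trans hscale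
  simp only [planeFactor_eq]
  exact hasymp'.add ((hrem (one_pow 2)).sub (hrem neg_one_sq))

lemma sign_mul_of_pos {r : ℝ} (hr : 0 < r) (x : ℝ) : Real.sign (r * x) = Real.sign x := by
  rcases lt_trichotomy x 0 with hx | rfl | hx
  · rw [Real.sign_of_neg hx, Real.sign_of_neg (mul_neg_of_pos_of_neg hr hx)]
  · rw [mul_zero]
  · rw [Real.sign_of_pos hx, Real.sign_of_pos (mul_pos hr hx)]

lemma eventually_sign_eq_of_tendsto {ι : Type*} {l : Filter ι} {h : ι → ℝ} {p : ℝ}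
    (hh : Tendsto h l (𝓝 p)) (hp : p ≠ 0) : ∀ᶠ i in l, Real.sign (h i) = Real.sign p := by
  have hpp : 0 < p * p := mul_self_pos.2 hp
  filter_upwards [(hh.mul_const p).eventually_const_lt hpp] with i hi
  exact sign_eq_sign_of_mul_pos hi

lemma eventually_asympE_eq (k : ℕ) {u : ℝ} (hu : u ^ 2 = 1) {x : ℝ × ℝ}
    (hx : u * x.1 - x.2 ≠ 0) :
    ∀ᶠ t in 𝓝[>] (0 : ℝ), asympE k (B₁ (u, 1 + t) x / √(-Q₁ (u, 1 + t))) =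
      asympE k (u * x.1 - x.2) := by
  have hlim : Tendsto (fun t => u * x.1 - x.2 - scale t ^ 2 * (u * x.1 + x.2) / 2) (𝓝[>] 0)
      (𝓝 (u * x.1 - x.2)) := by
    have hs := tendsto_scale.mono_right nhdsWithin_le_nhds
    simpa using (((hs.pow 2).mul_const (u * x.1 + x.2)).div_const 2).const_sub (u * x.1 - x.2)
  filter_upwards [eventually_sign_eq_of_tendsto hlim hx, self_mem_nhdsWithin] with t ht ht'
  have hs := scale_pos ht'
  rw [asympE, asympE, B₁_div_sqrt_neg_Q₁ hu ht', ← ht,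
    ← sign_mul_of_pos (inv_pos.2 hs) (u * x.1 - x.2 - _)]
  congr 2
  field_simp

lemma tendsto_planeFactor (k : ℕ) (g : Poly 1) {x : ℝ × ℝ} (h₁ : x.1 - x.2 ≠ 0)
    (h₂ : x.1 + x.2 ≠ 0) :
    Tendsto (fun t => planeFactor k g (1, 1 + t) (-1, 1 + t) x) (𝓝[>] 0)
      (𝓝 (((asympE k (x.1 - x.2) - asympE k (-x.1 - x.2) : ℝ) : ℂ) * evalAt g fun _ => x)) := by
  obtain ⟨δ, hδ, hx⟩ : ∃ δ, 0 < δ ∧ x ∈ awayFromLightCone δ :=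
    ⟨min |x.1 - x.2| |x.1 + x.2|, lt_min (abs_pos.2 h₁) (abs_pos.2 h₂), min_le_left _ _,
      min_le_right _ _⟩
  have hmem : Tendsto (fun t => (t, x)) (𝓝[>] 0) (𝓟 (Set.Ioi (0 : ℝ) ×ˢ awayFromLightCone δ)) :=
    tendsto_principal.2 (eventually_mem_nhdsWithin.mono fun t ht => ⟨ht, hx⟩)
  have hscale : Tendsto (fun t => scale t * majorant (δ / 4) x) (𝓝[>] 0) (𝓝 0) := by
    simpa using (tendsto_scale.mono_right nhdsWithin_le_nhds).mul_const (majorant (δ / 4) x)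
  have hrem {u : ℝ} (hu : u ^ 2 = 1) :
      Tendsto (fun t => planeTerm (remE k) k g (u, 1 + t) x) (𝓝[>] 0) (𝓝 0) :=
    ((planeTerm_remE_isBigO k g hu hδ).comp_tendsto hmem).trans_tendsto hscale
  have hasymp : Tendsto (fun t =>
      ((asympE k (B₁ (1, 1 + t) x / √(-Q₁ (1, 1 + t))) -
        asympE k (B₁ (-1, 1 + t) x / √(-Q₁ (-1, 1 + t))) : ℝ) : ℂ) * evalAt g fun _ => x)
      (𝓝[>] 0)
      (𝓝 (((asympE k (x.1 - x.2) - asympE k (-x.1 - x.2) : ℝ) : ℂ) * evalAt g fun _ => x)) := by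
    refine tendsto_nhds_of_eventually_eq ?_
    filter_upwards [eventually_asympE_eq k (one_pow 2) (by rwa [one_mul]),
      eventually_asympE_eq k neg_one_sq (x := x)
        (by rwa [neg_one_mul, ← neg_add', neg_ne_zero])] with t ht₁ ht₂
    rw [ht₁, ht₂, one_mul, neg_one_mul]
  simp only [planeFactor_eq]
  simpa using hasymp.add ((hrem (one_pow 2)).sub (hrem neg_one_sq))

/-! ### Factorisation over the planes -/

/-- The inclusion of the polynomials in `(x, y)` as the polynomials in `(xⱼ, yⱼ)`. -/
def planeIncl {m : ℕ} (j : Fin m) : Poly 1 →ₐ[ℂ] Poly m :=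
  MvPolynomial.rename (Sum.map (fun _ => j) (fun _ => j))

lemma evalAt_prod_planeIncl {m : ℕ} (g : Fin m → Poly 1) (x : Vec m) :
    evalAt (∏ j, planeIncl j (g j)) x = ∏ j, evalAt (g j) fun _ => x j := by
  refine (map_prod _ _ _).trans (Finset.prod_congr rfl fun j _ => ?_)
  rw [planeIncl, MvPolynomial.eval_rename, evalAt, Sum.elim_comp_map]
  rfl

lemma dirDeriv_mul {m : ℕ} (c : ℝ × ℝ) (j : Fin m) (f g : Poly m) :
    dirDeriv c j (f * g) = dirDeriv c j f * g + f * dirDeriv c j g := by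
  simp only [dirDeriv_apply, MvPolynomial.pderiv_mul, MvPolynomial.smul_eq_C_mul]
  ring

lemma dirDeriv_planeIncl_self {m : ℕ} (c : ℝ × ℝ) (j : Fin m) (g : Poly 1) :
    dirDeriv c j (planeIncl j g) = planeIncl j (dirDeriv c 0 g) := by
  have hinj : Function.Injective (Sum.map (fun _ : Fin 1 => j) (fun _ : Fin 1 => j)) :=
    Sum.map_injective.2
      ⟨Function.injective_of_subsingleton _, Function.injective_of_subsingleton _⟩
  rw [dirDeriv_apply, dirDeriv_apply, map_add, map_smul, map_smul, planeIncl,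
    ← MvPolynomial.pderiv_rename hinj, ← MvPolynomial.pderiv_rename hinj]
  rfl

lemma dirDeriv_prod_planeIncl_of_notMem {m : ℕ} (c : ℝ × ℝ) {i : Fin m} {s : Finset (Fin m)}
    (hi : i ∉ s) (g : Fin m → Poly 1) : dirDeriv c i (∏ j ∈ s, planeIncl j (g j)) = 0 := by
  classical
  have hvars : ∀ v ∈ (∏ j ∈ s, planeIncl j (g j)).vars, ∃ j ∈ s, v = Sum.inl j ∨ v = Sum.inr j := by
    intro v hv
    obtain ⟨j, hj, hv⟩ := Finset.mem_biUnion.1 (MvPolynomial.vars_prod _ hv)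
    obtain ⟨w | w, -, rfl⟩ := Finset.mem_image.1 (MvPolynomial.vars_rename _ _ hv)
    exacts [⟨j, hj, .inl rfl⟩, ⟨j, hj, .inr rfl⟩]
  have hinl : Sum.inl i ∉ (∏ j ∈ s, planeIncl j (g j)).vars := fun h => by
    obtain ⟨j, hj, h | h⟩ := hvars _ h
    exacts [hi (Sum.inl_injective h ▸ hj), absurd h Sum.inl_ne_inr]
  have hinr : Sum.inr i ∉ (∏ j ∈ s, planeIncl j (g j)).vars := fun h => by
    obtain ⟨j, hj, h | h⟩ := hvars _ h
    exacts [absurd h Sum.inr_ne_inl, hi (Sum.inr_injective h ▸ hj)]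
  rw [dirDeriv_apply, MvPolynomial.pderiv_eq_zero_of_notMem_vars hinl,
    MvPolynomial.pderiv_eq_zero_of_notMem_vars hinr, smul_zero, smul_zero, add_zero]

lemma dirDeriv_prod_planeIncl {m : ℕ} (c : ℝ × ℝ) (i : Fin m) (g : Fin m → Poly 1) :
    dirDeriv c i (∏ j, planeIncl j (g j)) =
      ∏ j, planeIncl j (Function.update g i (dirDeriv c 0 (g i)) j) := by
  rw [← Finset.mul_prod_erase _ _ (Finset.mem_univ i), dirDeriv_mul,
    dirDeriv_prod_planeIncl_of_notMem c (Finset.notMem_erase i _), mul_zero, add_zero,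
    dirDeriv_planeIncl_self, ← Finset.mul_prod_erase _ _ (Finset.mem_univ i), Function.update_self]
  congr 1
  exact Finset.prod_congr rfl fun j hj => by
    rw [Function.update_of_ne (Finset.ne_of_mem_erase hj)]

lemma dirDeriv_pow_prod_planeIncl {m : ℕ} (c : ℝ × ℝ) (i : Fin m) (k : ℕ) (g : Fin m → Poly 1) :
    (dirDeriv c i ^ k) (∏ j, planeIncl j (g j)) =
      ∏ j, planeIncl j (Function.update g i ((dirDeriv c 0 ^ k) (g i)) j) := by
  induction k generalizing g with
  | zero => simp
  | succ k ih =>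
    rw [pow_succ, Module.End.mul_apply, dirDeriv_prod_planeIncl, ih, Function.update_self,
      Function.update_idem, pow_succ, Module.End.mul_apply]

lemma list_prod_dirDeriv_pow_prod_planeIncl {m : ℕ} (c : Vec m) (κ : Fin m → ℕ)
    (g : Fin m → Poly 1) {l : List (Fin m)} (hl : l.Nodup) :
    (l.map fun j => dirDeriv (c j) j ^ κ j).prod (∏ j, planeIncl j (g j)) =
      ∏ j, planeIncl j (if j ∈ l then (dirDeriv (c j) 0 ^ κ j) (g j) else g j) := by
  induction l with
  | nil => simp
  | cons i l ih =>
    rw [List.nodup_cons] at hl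
    rw [List.map_cons, List.prod_cons, Module.End.mul_apply, ih hl.2, dirDeriv_pow_prod_planeIncl]
    refine Finset.prod_congr rfl fun j _ => ?_
    rcases eq_or_ne j i with rfl | hj
    · simp [hl.1]
    · simp [hj]

lemma G_prod_planeIncl {m : ℕ} (c : Vec m) (κ : Fin m → ℕ) (g : Fin m → Poly 1) :
    G c κ (∏ j, planeIncl j (g j)) = ∏ j, planeIncl j ((dirDeriv (c j) 0 ^ κ j) (g j)) := by
  rw [G, List.ofFn_eq_map, list_prod_dirDeriv_pow_prod_planeIncl c κ g (List.nodup_finRange m)]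
  simp only [List.mem_finRange, if_true]

/-- The part `x^{aₓ} y^{a_y}` of the monomial with exponents `a` that involves the variables of the
`j`-th plane, as a polynomial in the coordinates of a single plane. -/
def monomialPart {m : ℕ} (a : (Fin m ⊕ Fin m) →₀ ℕ) (j : Fin m) : Poly 1 :=
  MvPolynomial.X (Sum.inl 0) ^ a (Sum.inl j) * MvPolynomial.X (Sum.inr 0) ^ a (Sum.inr j)

lemma monomial_eq_prod_planeIncl {m : ℕ} (a : (Fin m ⊕ Fin m) →₀ ℕ) :
    MvPolynomial.monomial a (1 : ℂ) = ∏ j, planeIncl j (monomialPart a j) := by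
  rw [MvPolynomial.monomial_eq, Finsupp.prod_fintype _ _ (fun _ => pow_zero _),
    Fintype.prod_sum_type, ← Finset.prod_mul_distrib, MvPolynomial.C_1, one_mul]
  simp [planeIncl, monomialPart]

lemma eq_sum_smul_prod_planeIncl {m : ℕ} (f : Poly m) :
    f = ∑ a ∈ f.support, f.coeff a • ∏ j, planeIncl j (monomialPart a j) := by
  conv_lhs => rw [f.as_sum]
  refine Finset.sum_congr rfl fun a _ => ?_
  rw [← monomial_eq_prod_planeIncl, MvPolynomial.smul_monomial, smul_eq_mul, mul_one]

lemma evalAt_sum_smul {m : ℕ} {ι : Type*} (s : Finset ι) (a : ι → ℂ) (f : ι → Poly m) (x : Vec m) :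
    evalAt (∑ i ∈ s, a i • f i) x = ∑ i ∈ s, a i * evalAt (f i) x :=
  (map_sum _ _ _).trans (Finset.sum_congr rfl fun _ _ => evalAt_smul _ _ _)

lemma evalAt_eq_sum {m : ℕ} (f : Poly m) (x : Vec m) :
    evalAt f x = ∑ a ∈ f.support, f.coeff a * ∏ j, evalAt (monomialPart a j) fun _ => x j := by
  conv_lhs => rw [eq_sum_smul_prod_planeIncl f]
  simp only [evalAt_sum_smul, evalAt_prod_planeIncl]

lemma evalAt_G_eq_sum {m : ℕ} (c : Vec m) (κ : Fin m → ℕ) (f : Poly m) (x : Vec m) :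
    evalAt (G c κ f) x = ∑ a ∈ f.support, f.coeff a *
      ∏ j, evalAt ((dirDeriv (c j) 0 ^ κ j) (monomialPart a j)) fun _ => x j := by
  have hG : G c κ f =
      ∑ a ∈ f.support, f.coeff a • G c κ (∏ j, planeIncl j (monomialPart a j)) := by
    conv_lhs => rw [eq_sum_smul_prod_planeIncl f]
    simp only [G, map_sum, map_smul]
  simp only [hG, evalAt_sum_smul, G_prod_planeIncl, evalAt_prod_planeIncl]

lemma F_mul_evalAt_G {m : ℕ} (c : Vec m) (κ : Fin m → ℕ) (f : Poly m) (x : Vec m) :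
    (F c κ x : ℂ) * evalAt (G c κ f) x = ∑ a ∈ f.support, f.coeff a *
      ∏ j, planeTerm (iteratedDeriv (κ j) E) (κ j) (monomialPart a j) (c j) (x j) := by
  rw [evalAt_G_eq_sum, Finset.mul_sum]
  refine Finset.sum_congr rfl fun a _ => ?_
  rw [mul_left_comm, F, Complex.ofReal_prod, ← Finset.prod_mul_distrib]
  rfl

lemma prod_sub_eq_sum_fin_two {ι R : Type*} [Fintype ι] [DecidableEq ι] [CommRing R]
    (a b : ι → R) :
    ∏ j, (a j - b j) =
      ∑ σ : ι → Fin 2, (-1) ^ (∑ j, (σ j : ℕ)) * ∏ j, ![a j, b j] (σ j) := by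
  have hsub (j : ι) : a j - b j = ∑ s : Fin 2, (-1) ^ (s : ℕ) * ![a j, b j] s := by
    simp [sub_eq_add_neg]
  simp only [hsub, Finset.prod_univ_sum, Fintype.piFinset_univ, Finset.prod_mul_distrib,
    Finset.prod_pow_eq_pow_sum]

lemma prod_planeFactor_eq_sum {m : ℕ} (κ : Fin m → ℕ) (g : Fin m → Poly 1) (c c' x : Vec m) :
    ∏ j, planeFactor (κ j) (g j) (c j) (c' j) (x j) =
      ∑ σ : Fin m → Fin 2, (-1) ^ (∑ j, (σ j : ℕ)) *
        ∏ j, planeTerm (iteratedDeriv (κ j) E) (κ j) (g j) (![c j, c' j] (σ j)) (x j) := by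
  have hvec (j : Fin m) : ∀ s : Fin 2,
      ![planeTerm (iteratedDeriv (κ j) E) (κ j) (g j) (c j) (x j),
        planeTerm (iteratedDeriv (κ j) E) (κ j) (g j) (c' j) (x j)] s =
      planeTerm (iteratedDeriv (κ j) E) (κ j) (g j) (![c j, c' j] s) (x j) :=
    Fin.forall_fin_two.2 ⟨rfl, rfl⟩
  simp only [planeFactor, prod_sub_eq_sum_fin_two, hvec]

lemma p_eq_sum_prod_planeFactor {m : ℕ} (c c' : Vec m) (f : Poly m) (x : Vec m) :
    p c c' f x = ∑ k ∈ Finset.range (f.totalDegree + 1),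
      ∑ κ ∈ Finset.piAntidiag (Finset.univ : Finset (Fin m)) k, ∑ a ∈ f.support,
        ((-1 : ℂ) ^ k / (4 * (Real.pi : ℂ)) ^ k * f.coeff a) *
          ∏ j, planeFactor (κ j) (monomialPart a j) (c j) (c' j) (x j) := by
  simp only [p, F_mul_evalAt_G, prod_planeFactor_eq_sum, Finset.mul_sum]
  rw [Finset.sum_comm]
  refine Finset.sum_congr rfl fun k _ => ?_
  rw [Finset.sum_comm]
  refine Finset.sum_congr rfl fun κ _ => ?_
  rw [Finset.sum_comm]
  refine Finset.sum_congr rfl fun a _ => Finset.sum_congr rfl fun σ _ => ?_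
  ring

/-! ### Domination on the shifted lattice -/

lemma prod_planeFactor_isBigO_prod_majorant {m : ℕ} (κ : Fin m → ℕ) (g : Fin m → Poly 1) {δ : ℝ}
    (hδ : 0 < δ) :
    (fun z : ℝ × Vec m => ∏ j, planeFactor (κ j) (g j) (c₀ m z.1 j) (c₁ m z.1 j) (z.2 j))
      =O[𝓟 (Set.Ioi 0 ×ˢ Set.univ.pi fun _ => awayFromLightCone δ)]
        fun z => ∏ j, majorant (δ / 4) (z.2 j) := by
  have hplane (j : Fin m) :
      Tendsto (fun z : ℝ × Vec m => (z.1, z.2 j))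
        (𝓟 (Set.Ioi 0 ×ˢ Set.univ.pi fun _ => awayFromLightCone δ))
        (𝓟 (Set.Ioi 0 ×ˢ awayFromLightCone δ)) :=
    tendsto_principal_principal.2 fun z hz => ⟨hz.1, hz.2 j trivial⟩
  have hfactor (j : Fin m) :
      (fun z : ℝ × Vec m => planeFactor (κ j) (g j) (c₀ m z.1 j) (c₁ m z.1 j) (z.2 j))
        =O[𝓟 (Set.Ioi 0 ×ˢ Set.univ.pi fun _ => awayFromLightCone δ)]
          fun z => majorant (δ / 4) (z.2 j) :=
    ((planeFactor_isBigO_majorant (κ j) (g j) hδ).comp_tendsto (hplane j) :)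
  exact .finsetProd fun j _ => hfactor j

lemma p_isBigO_prod_majorant {m : ℕ} (f : Poly m) {δ : ℝ} (hδ : 0 < δ) :
    (fun z : ℝ × Vec m => p (c₀ m z.1) (c₁ m z.1) f z.2)
      =O[𝓟 (Set.Ioi 0 ×ˢ Set.univ.pi fun _ => awayFromLightCone δ)]
        fun z => ∏ j, majorant (δ / 4) (z.2 j) := by
  simp only [p_eq_sum_prod_planeFactor]
  exact .fun_sum fun k _ => .fun_sum fun κ _ => .fun_sum fun a _ =>
    (prod_planeFactor_isBigO_prod_majorant κ (monomialPart a) hδ).const_mul_left _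

lemma norm_qPow (τ : UpperHalfPlane) (r : ℝ) :
    ‖qPow τ r‖ = Real.exp (-(2 * Real.pi * (τ.im * r))) := by
  rw [qPow, Complex.norm_exp]
  congr 1
  simp
  ring

lemma norm_e (r : ℝ) : ‖e r‖ = 1 := by
  rw [e, Complex.norm_exp]
  simp

lemma Q₁_smul (r : ℝ) (x : ℝ × ℝ) : Q₁ (r • x) = r ^ 2 * Q₁ x := by
  simp only [Q₁, Prod.smul_fst, Prod.smul_snd, smul_eq_mul]
  ring

lemma prod_majorant_mul_norm_qPow {m : ℕ} (ε : ℝ) (τ : UpperHalfPlane) (x : Vec m) :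
    (∏ j, majorant ε ((√τ.im • x) j)) * ‖qPow τ (Q x)‖ =
      ∏ j, Real.exp (-(ε * √τ.im * ‖x j‖)) := by
  have hqPow : ‖qPow τ (Q x)‖ = ∏ j, Real.exp (-(2 * Real.pi * Q₁ ((√τ.im • x) j))) := by
    rw [norm_qPow, ← Real.exp_sum, Q, Finset.mul_sum, Finset.mul_sum, Finset.sum_neg_distrib]
    simp only [Pi.smul_apply, Q₁_smul, Real.sq_sqrt τ.im_pos.le]
  rw [hqPow, ← Finset.prod_mul_distrib]
  refine Finset.prod_congr rfl fun j _ => ?_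
  rw [majorant, ← Real.exp_add, Pi.smul_apply, norm_smul, Real.norm_of_nonneg (Real.sqrt_nonneg _)]
  ring_nf

lemma exists_norm_thetaTerm_le {m : ℕ} (τ : UpperHalfPlane) {δ : ℝ} (hδ : 0 < δ) (b : Vec m)
    (f : Poly m) : ∃ C, ∀ t, 0 < t → ∀ x : Vec m, (∀ j, (√τ.im • x) j ∈ awayFromLightCone δ) →
      ‖thetaTerm (c₀ m t) (c₁ m t) b f τ x‖ ≤
        C * ∏ j, Real.exp (-(δ / 4 * √τ.im * ‖x j‖)) := by
  obtain ⟨C, hC⟩ := isBigO_principal.1 (p_isBigO_prod_majorant f hδ)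
  refine ⟨C, fun t ht x hx => ?_⟩
  have hp : ‖p (c₀ m t) (c₁ m t) f (√τ.im • x)‖ ≤
      C * ∏ j, majorant (δ / 4) ((√τ.im • x) j) := by
    refine (hC (t, √τ.im • x) ⟨ht, fun j _ => hx j⟩).trans_eq ?_
    rw [Real.norm_of_nonneg (Finset.prod_nonneg fun j _ => (majorant_pos _ _).le)]
  rw [thetaTerm, norm_mul, norm_mul, norm_e, mul_one, ← prod_majorant_mul_norm_qPow, ← mul_assoc]
  exact mul_le_mul_of_nonneg_right hp (norm_nonneg _)

lemma eventually_forall_le_abs_add_intCast {α : ℝ} (h : ¬ ∃ n : ℤ, α = n) :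
    ∀ᶠ δ in 𝓝 (0 : ℝ), ∀ n : ℤ, δ ≤ |α + n| := by
  have hround : 0 < |α - round α| := abs_pos.2 fun h0 => h ⟨round α, sub_eq_zero.1 h0⟩
  filter_upwards [eventually_le_nhds hround] with δ hδ n
  simpa using hδ.trans (round_le α (-n))

lemma smul_mem_awayFromLightCone {δ r : ℝ} (hr : 0 ≤ r) {x : ℝ × ℝ}
    (hx : x ∈ awayFromLightCone δ) : r • x ∈ awayFromLightCone (r * δ) := by
  simp only [awayFromLightCone, Set.mem_ofPred_eq, Prod.smul_fst, Prod.smul_snd, smul_eq_mul,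
    ← mul_sub, ← mul_add, abs_mul, abs_of_nonneg hr]
  exact ⟨mul_le_mul_of_nonneg_left hx.1 hr, mul_le_mul_of_nonneg_left hx.2 hr⟩

lemma exists_forall_shift_mem_awayFromLightCone {m : ℕ} {a : Vec m}
    (ha : ∀ j, (¬ ∃ n : ℤ, B₁ (1, 1) (a j) = n) ∧ (¬ ∃ n : ℤ, B₁ (-1, 1) (a j) = n)) :
    ∃ δ > 0, ∀ n j, shift a n j ∈ awayFromLightCone δ := by
  have hplane (j : Fin m) : ∀ᶠ δ in 𝓝 (0 : ℝ), ∀ n, shift a n j ∈ awayFromLightCone δ := by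
    filter_upwards [eventually_forall_le_abs_add_intCast (ha j).1,
      eventually_forall_le_abs_add_intCast (ha j).2] with δ h₁ h₂ n
    refine ⟨(h₁ ((n j).1 - (n j).2)).trans_eq ?_, (h₂ (-(n j).1 - (n j).2)).trans_eq ?_⟩
    · simp only [shift, B₁]
      push_cast
      ring_nf
    · rw [← abs_neg]
      simp only [shift, B₁]
      push_cast
      ring_nf
  have hall : ∀ᶠ δ in 𝓝[>] (0 : ℝ), ∀ j n, shift a n j ∈ awayFromLightCone δ :=
    nhdsWithin_le_nhds (eventually_all.2 hplane)
  obtain ⟨δ, hmem, hδ⟩ := (hall.and self_mem_nhdsWithin).exists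
  exact ⟨δ, hδ, fun n j => hmem j n⟩

lemma summable_exp_neg_mul_abs_add_intCast {ε : ℝ} (hε : 0 < ε) (α : ℝ) :
    Summable fun n : ℤ => Real.exp (-(ε * |α + n|)) := by
  have hle (n : ℤ) : Real.exp (-(ε * |α + n|)) ≤ Real.exp (ε * |α|) * Real.exp (n.natAbs * -ε) := by
    rw [← Real.exp_add, Real.exp_le_exp, Nat.cast_natAbs, Int.cast_abs]
    have hn := mul_le_mul_of_nonneg_left (abs_sub (α + n) α) hε.le
    rw [add_sub_cancel_left] at hn
    linarith
  have hnat : Summable fun n : ℕ => Real.exp (n * -ε) :=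
    Real.summable_exp_nat_mul_iff.2 (neg_lt_zero.2 hε)
  have hint : Summable fun n : ℤ => Real.exp (n.natAbs * -ε) :=
    .of_nat_of_neg (by simpa using hnat) (by simpa using hnat)
  exact .of_nonneg_of_le (fun n => (Real.exp_pos _).le) hle (hint.mul_left _)

lemma summable_pi_prod {m : ℕ} {α : Fin m → Type*} {h : ∀ j, α j → ℝ} (h₀ : ∀ j a, 0 ≤ h j a)
    (hs : ∀ j, Summable (h j)) : Summable fun n : ∀ j, α j => ∏ j, h j (n j) := by
  induction m with
  | zero => exact .of_finite
  | succ m ih =>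
    have htail := ih (fun j => h₀ j.succ) fun j => hs j.succ
    rw [← (Fin.consEquiv α).summable_iff]
    refine ((hs 0).mul_of_nonneg htail (h₀ 0) fun n => Finset.prod_nonneg fun j _ => h₀ _ _).congr
      fun n => ?_
    simp [Fin.prod_univ_succ, Fin.consEquiv]

lemma summable_prod_exp_neg_mul_norm_shift {m : ℕ} {ε : ℝ} (hε : 0 < ε) (a : Vec m) :
    Summable fun n : Fin m → ℤ × ℤ => ∏ j, Real.exp (-(ε * ‖shift a n j‖)) := by
  have hplane (j : Fin m) :
      Summable fun n : ℤ × ℤ => Real.exp (-(ε * ‖shift a (fun _ => n) j‖)) := by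
    have hcoord := summable_exp_neg_mul_abs_add_intCast (half_pos hε)
    refine .of_nonneg_of_le (fun n => (Real.exp_pos _).le) (fun n => ?_)
      ((hcoord (a j).1).mul_of_nonneg (hcoord (a j).2)
        (fun _ => (Real.exp_pos _).le) fun _ => (Real.exp_pos _).le)
    rw [← Real.exp_add, Real.exp_le_exp, shift, Prod.norm_mk, Real.norm_eq_abs, Real.norm_eq_abs]
    nlinarith [le_max_left |(a j).1 + n.1| |(a j).2 + n.2|,
      le_max_right |(a j).1 + n.1| |(a j).2 + n.2|]
  exact summable_pi_prod (h := fun j n => Real.exp (-(ε * ‖shift a (fun _ => n) j‖)))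
    (fun _ _ => (Real.exp_pos _).le) hplane

lemma exists_summable_norm_thetaTerm_shift_le {m : ℕ} (τ : UpperHalfPlane) {a : Vec m}
    (ha : ∀ j, (¬ ∃ n : ℤ, B₁ (1, 1) (a j) = n) ∧ (¬ ∃ n : ℤ, B₁ (-1, 1) (a j) = n))
    (b : Vec m) (f : Poly m) :
    ∃ h : (Fin m → ℤ × ℤ) → ℝ, Summable h ∧ ∀ t, 0 < t → ∀ n,
      ‖thetaTerm (c₀ m t) (c₁ m t) b f τ (shift a n)‖ ≤ h n := by
  have hv : 0 < √τ.im := Real.sqrt_pos.2 τ.im_pos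
  obtain ⟨δ, hδ, hmem⟩ := exists_forall_shift_mem_awayFromLightCone ha
  obtain ⟨C, hC⟩ := exists_norm_thetaTerm_le τ (mul_pos hv hδ) b f
  refine ⟨_, (summable_prod_exp_neg_mul_norm_shift (ε := √τ.im * δ / 4 * √τ.im)
    (by positivity) a).mul_left C, fun t ht n => hC t ht _ fun j => ?_⟩
  exact smul_mem_awayFromLightCone hv.le (hmem n j)

lemma summable_thetaTerm {m : ℕ} (τ : UpperHalfPlane) {a : Vec m}
    (ha : ∀ j, (¬ ∃ n : ℤ, B₁ (1, 1) (a j) = n) ∧ (¬ ∃ n : ℤ, B₁ (-1, 1) (a j) = n))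
    (b : Vec m) (f : Poly m) {t : ℝ} (ht : 0 < t) :
    Summable fun n => thetaTerm (c₀ m t) (c₁ m t) b f τ (shift a n) := by
  obtain ⟨h, hh, hle⟩ := exists_summable_norm_thetaTerm_shift_le τ ha b f
  exact .of_norm_bounded hh (hle t ht)

/-! ### The limit -/

lemma signWeight_mul_evalAt_eq_sum {m : ℕ} (f : Poly m) (x : Vec m) :
    (signWeight x : ℂ) * evalAt f x = ∑ k ∈ Finset.range (f.totalDegree + 1),
      ∑ κ ∈ Finset.piAntidiag (Finset.univ : Finset (Fin m)) k, ∑ a ∈ f.support,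
        ((-1 : ℂ) ^ k / (4 * (Real.pi : ℂ)) ^ k * f.coeff a) *
          ∏ j, ((asympE (κ j) ((x j).1 - (x j).2) - asympE (κ j) (-(x j).1 - (x j).2) : ℝ) : ℂ) *
            evalAt (monomialPart a j) fun _ => x j := by
  rw [Finset.sum_eq_single_of_mem 0 (by simp)]
  · rw [Finset.piAntidiag_zero, Finset.sum_singleton, evalAt_eq_sum, Finset.mul_sum]
    refine Finset.sum_congr rfl fun a _ => ?_
    simp only [Pi.zero_apply, asympE, if_true, Finset.prod_mul_distrib, signWeight,
      Complex.ofReal_prod]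
    ring
  · intro k _ hk
    refine Finset.sum_eq_zero fun κ hκ => Finset.sum_eq_zero fun a _ => ?_
    obtain ⟨j, -, hj⟩ :=
      Finset.exists_ne_zero_of_sum_ne_zero ((Finset.mem_piAntidiag.1 hκ).1.trans_ne hk)
    rw [Finset.prod_eq_zero (Finset.mem_univ j) (by simp [asympE, hj]), mul_zero]

lemma tendsto_p {m : ℕ} (f : Poly m) {x : Vec m} (h₁ : ∀ j, (x j).1 - (x j).2 ≠ 0)
    (h₂ : ∀ j, (x j).1 + (x j).2 ≠ 0) :
    Tendsto (fun t => p (c₀ m t) (c₁ m t) f x) (𝓝[>] 0)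
      (𝓝 ((signWeight x : ℂ) * evalAt f x)) := by
  have hprod (κ : Fin m → ℕ) (a : (Fin m ⊕ Fin m) →₀ ℕ) := tendsto_finsetProd Finset.univ
    fun j _ => tendsto_planeFactor (κ j) (monomialPart a j) (h₁ j) (h₂ j)
  have hsum := tendsto_finsetSum (Finset.range (f.totalDegree + 1)) fun k _ =>
    tendsto_finsetSum (Finset.piAntidiag (Finset.univ : Finset (Fin m)) k) fun κ _ =>
      tendsto_finsetSum f.support fun a _ => (hprod κ a).const_mul
        ((-1 : ℂ) ^ k / (4 * (Real.pi : ℂ)) ^ k * f.coeff a)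
  simp only [p_eq_sum_prod_planeFactor, signWeight_mul_evalAt_eq_sum]
  exact hsum

lemma signWeight_smul {m : ℕ} {r : ℝ} (hr : 0 < r) (x : Vec m) :
    signWeight (r • x) = signWeight x := by
  simp only [signWeight, Pi.smul_apply, Prod.smul_fst, Prod.smul_snd, smul_eq_mul, ← mul_neg,
    ← mul_sub, sign_mul_of_pos hr]

lemma evalAt_smul_of_isHomogeneous {m d : ℕ} {f : Poly m} (hf : f.IsHomogeneous d) (r : ℝ)
    (x : Vec m) : evalAt f (r • x) = (r : ℂ) ^ d * evalAt f x := by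
  have hcoord (i : Fin m ⊕ Fin m) :
      Sum.elim (fun j => (((r • x) j).1 : ℂ)) (fun j => (((r • x) j).2 : ℂ)) i =
        r * Sum.elim (fun j => ((x j).1 : ℂ)) (fun j => ((x j).2 : ℂ)) i := by
    cases i <;> simp
  simp only [evalAt, MvPolynomial.eval_eq, hcoord, mul_pow, Finset.prod_mul_distrib,
    Finset.prod_pow_eq_pow_sum, Finset.mul_sum]
  refine Finset.sum_congr rfl fun a ha => ?_
  rw [← hf.degree_eq_sum_deg_support ha, mul_left_comm]

lemma isHomogeneous_totalDegree {ι R : Type*} [CommSemiring R] {f : MvPolynomial ι R} {d : ℕ}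
    (hf : f.IsHomogeneous d) : f.IsHomogeneous f.totalDegree := by
  rcases eq_or_ne f 0 with rfl | hf0
  · exact MvPolynomial.isHomogeneous_zero _ _ _
  · rwa [hf.totalDegree hf0]

lemma rpow_neg_div_two_mul_sqrt_pow {v : ℝ} (hv : 0 < v) (d : ℕ) :
    v ^ (-(d : ℝ) / 2) * √v ^ d = 1 := by
  rw [Real.rpow_div_two_eq_sqrt _ hv.le, Real.rpow_neg (Real.sqrt_nonneg v), Real.rpow_natCast,
    inv_mul_cancel₀ (pow_pos (Real.sqrt_pos.2 hv) d).ne']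

lemma tendsto_thetaTerm {m d : ℕ} (τ : UpperHalfPlane) (b : Vec m) {f : Poly m}
    (hf : f.IsHomogeneous d) {x : Vec m} (h₁ : ∀ j, (x j).1 - (x j).2 ≠ 0)
    (h₂ : ∀ j, (x j).1 + (x j).2 ≠ 0) :
    Tendsto (fun t => thetaTerm (c₀ m t) (c₁ m t) b f τ x) (𝓝[>] 0)
      (𝓝 ((√τ.im : ℂ) ^ d * signTerm b f τ x)) := by
  have hv : 0 < √τ.im := Real.sqrt_pos.2 τ.im_pos
  have hp := tendsto_p f (x := √τ.im • x)
    (fun j => by simpa [← mul_sub, hv.ne'] using h₁ j)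
    (fun j => by simpa [← mul_add, hv.ne'] using h₂ j)
  have hvalue : (√τ.im : ℂ) ^ d * signTerm b f τ x =
      signWeight (√τ.im • x) * evalAt f (√τ.im • x) * qPow τ (Q x) * e (B x b) := by
    rw [signWeight_smul hv, evalAt_smul_of_isHomogeneous hf, signTerm]
    ring
  rw [hvalue]
  exact (hp.mul_const (qPow τ (Q x))).mul_const (e (B x b))

section ShiftedLattice

variable {m d : ℕ} (τ : UpperHalfPlane) {f : Poly m} (hf : f.IsHomogeneous d) {a : Vec m}
  (ha : ∀ j, (¬ ∃ n : ℤ, B₁ (1, 1) (a j) = n) ∧ (¬ ∃ n : ℤ, B₁ (-1, 1) (a j) = n))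
  (b : Vec m)
include hf ha

lemma tendsto_thetaTerm_shift (n : Fin m → ℤ × ℤ) :
    Tendsto (fun t => thetaTerm (c₀ m t) (c₁ m t) b f τ (shift a n)) (𝓝[>] 0)
      (𝓝 ((√τ.im : ℂ) ^ d * signTerm b f τ (shift a n))) := by
  obtain ⟨δ, hδ, hmem⟩ := exists_forall_shift_mem_awayFromLightCone ha
  exact tendsto_thetaTerm τ b hf (fun j => abs_pos.1 (hδ.trans_le (hmem n j).1))
    fun j => abs_pos.1 (hδ.trans_le (hmem n j).2)

lemma summable_signTerm : Summable fun n => signTerm b f τ (shift a n) := by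
  obtain ⟨h, hh, hle⟩ := exists_summable_norm_thetaTerm_shift_le τ ha b f
  have hlimit : Summable fun n => (√τ.im : ℂ) ^ d * signTerm b f τ (shift a n) := by
    refine .of_norm_bounded hh fun n =>
      le_of_tendsto (tendsto_thetaTerm_shift τ hf ha b n).norm ?_
    filter_upwards [self_mem_nhdsWithin] with t ht using hle t ht n
  have hv : (√τ.im : ℂ) ≠ 0 := Complex.ofReal_ne_zero.2 (Real.sqrt_pos.2 τ.im_pos).ne'
  exact (summable_mul_left_iff (pow_ne_zero d hv)).1 hlimit

lemma tendsto_theta :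
    Tendsto (fun t => theta (c₀ m t) (c₁ m t) a b f τ) (𝓝[>] 0)
      (𝓝 (∑' n, signTerm b f τ (shift a n))) := by
  have hdeg := isHomogeneous_totalDegree hf
  obtain ⟨h, hh, hle⟩ := exists_summable_norm_thetaTerm_shift_le τ ha b f
  have hseries := tendsto_tsum_of_dominated_convergence hh
    (tendsto_thetaTerm_shift τ hdeg ha b) (by
      filter_upwards [self_mem_nhdsWithin] with t ht using hle t ht)
  have hweight : ((τ.im ^ (-(f.totalDegree : ℝ) / 2) : ℝ) : ℂ) *
      (√τ.im : ℂ) ^ f.totalDegree = 1 :=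
    mod_cast rpow_neg_div_two_mul_sqrt_pow τ.im_pos f.totalDegree
  rw [← one_mul (∑' n, signTerm b f τ (shift a n)), ← hweight, mul_assoc, ← tsum_mul_left]
  exact hseries.const_mul _

end ShiftedLattice

/-! ### The Kac-Wakimoto series -/

lemma exists_isHomogeneous_V (m : ℕ) : ∃ d, (V m).IsHomogeneous d := by
  have hX (i : Fin m ⊕ Fin m) : (MvPolynomial.X i : Poly m).IsHomogeneous 1 :=
    MvPolynomial.isHomogeneous_X ℂ i
  have hsub (i j : Fin m ⊕ Fin m) :
      (MvPolynomial.X i ^ 2 - MvPolynomial.X j ^ 2 : Poly m).IsHomogeneous (1 * 2) :=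
    ((hX i).pow 2).sub ((hX j).pow 2)
  exact ⟨_, (MvPolynomial.IsHomogeneous.prod _ _ _ fun i _ =>
    MvPolynomial.IsHomogeneous.prod _ _ _ fun j _ => (hsub _ _).mul (hsub _ _)).mul
      (MvPolynomial.IsHomogeneous.prod _ _ _ fun j _ => (hX _).mul (hX _))⟩

lemma qPow_sum {ι : Type*} (τ : UpperHalfPlane) (s : Finset ι) (r : ι → ℝ) :
    qPow τ (∑ j ∈ s, r j) = ∏ j ∈ s, qPow τ (r j) := by
  simp only [qPow, ← Complex.exp_sum, Complex.ofReal_sum, Finset.mul_sum]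

lemma e_sum {ι : Type*} (s : Finset ι) (r : ι → ℝ) :
    e (∑ j ∈ s, r j) = ∏ j ∈ s, e (r j) := by
  simp only [e, ← Complex.exp_sum, Complex.ofReal_sum, Finset.mul_sum]

lemma e_intCast_div_two_add_quarter (n : ℤ) :
    e ((n : ℝ) / 2 + 1 / 4) = Complex.I * (-1) ^ n := by
  have h : 2 * (Real.pi : ℂ) * Complex.I * (((n : ℝ) / 2 + 1 / 4 : ℝ) : ℂ) =
      Real.pi / 2 * Complex.I + n * (Real.pi * Complex.I) := by
    push_cast
    ring
  rw [e, h, Complex.exp_add, Complex.exp_pi_div_two_mul_I, Complex.exp_int_mul,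
    Complex.exp_pi_mul_I]

lemma shift_zero_half {m : ℕ} (n : Fin m → ℤ × ℤ) :
    shift (fun _ => (0, 1 / 2)) n = kwPoint n :=
  funext fun j => by simp only [shift, kwPoint, zero_add]

lemma e_B_kwPoint {m : ℕ} (n : Fin m → ℤ × ℤ) :
    e (B (kwPoint n) fun _ => (1 / 2, 1 / 2)) =
      Complex.I ^ m * ∏ j, (-1 : ℂ) ^ ((n j).1 - (n j).2 - 1) := by
  have hplane (j : Fin m) : e (B₁ (kwPoint n j) (1 / 2, 1 / 2)) =
      Complex.I * (-1 : ℂ) ^ ((n j).1 - (n j).2 - 1) := by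
    rw [← e_intCast_div_two_add_quarter, B₁, kwPoint]
    push_cast
    ring_nf
  simp only [B, e_sum, hplane, Finset.prod_mul_distrib, Finset.prod_const, Finset.card_univ,
    Fintype.card_fin]

lemma signTerm_V_shift {m : ℕ} (τ : UpperHalfPlane) (n : Fin m → ℤ × ℤ) :
    signTerm (fun _ => (1 / 2, 1 / 2)) (V m) τ (shift (fun _ => (0, 1 / 2)) n) =
      Complex.I ^ m * kwTerm τ n := by
  rw [signTerm, shift_zero_half, e_B_kwPoint, Q, qPow_sum, kwTerm, Finset.prod_mul_distrib]
  simp only [Q₁]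
  ring

lemma kwConst_ne_zero (m : ℕ) : kwConst m ≠ 0 :=
  mul_ne_zero (Nat.cast_ne_zero.2 m.factorial_ne_zero) <| pow_ne_zero _ <|
    Finset.prod_ne_zero_iff.2 fun _ _ => Nat.cast_ne_zero.2 (Nat.factorial_ne_zero _)

lemma tsum_signTerm_V_shift (m : ℕ) (τ : UpperHalfPlane) :
    ∑' n, signTerm (fun _ => (1 / 2, 1 / 2)) (V m) τ (shift (fun _ => (0, 1 / 2)) n) =
      (4 * Complex.I) ^ m * (m.factorial : ℂ) *
        (∏ j ∈ Finset.Icc 1 m, ((2 * j - 1).factorial : ℂ)) ^ 2 * KW m τ := by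
  have hc := kwConst_ne_zero m
  simp only [signTerm_V_shift]
  rw [tsum_mul_left, KW, mul_assoc _ (m.factorial : ℂ), ← kwConst, mul_pow]
  field_simp

lemma half_ne_intCast (n : ℤ) : (1 / 2 : ℝ) ≠ n := fun h => by
  have hodd : (1 : ℝ) = 2 * n := by linear_combination 2 * h
  have hodd' : (1 : ℤ) = 2 * n := mod_cast hodd
  omega

lemma B₁_zero_half_not_int {u : ℝ} : ¬ ∃ n : ℤ, B₁ (u, 1) (0, 1 / 2) = n := by
  rintro ⟨n, hn⟩
  refine half_ne_intCast (-n) ?_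
  rw [Int.cast_neg, ← hn, B₁]
  ring

lemma mem_cone_of_sq_eq_one {u : ℝ} (hu : u ^ 2 = 1) {t : ℝ} (ht : 0 < t) :
    (u, 1 + t) ∈ cone := by
  refine ⟨?_, by positivity⟩
  rw [Q₁, hu]
  nlinarith

end KWTheta

end

theorem theorem5p7_general (m : ℕ) (τ : UpperHalfPlane) :
    (∀ t : ℝ, 0 < t → ∀ j, KWTheta.c₀ m t j ∈ KWTheta.cone ∧ KWTheta.c₁ m t j ∈ KWTheta.cone) ∧
    (∀ (d : ℕ) (f : KWTheta.Poly m), f.IsHomogeneous d →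
      ∀ a : KWTheta.Vec m,
        (∀ j, (¬ ∃ n : ℤ, KWTheta.B₁ (1, 1) (a j) = n) ∧
          (¬ ∃ n : ℤ, KWTheta.B₁ (-1, 1) (a j) = n)) →
      ∀ b : KWTheta.Vec m,
        (∀ t : ℝ, 0 < t → Summable fun n : Fin m → ℤ × ℤ =>
          KWTheta.thetaTerm (KWTheta.c₀ m t) (KWTheta.c₁ m t) b f τ (KWTheta.shift a n)) ∧
        (Summable fun n : Fin m → ℤ × ℤ => KWTheta.signTerm b f τ (KWTheta.shift a n)) ∧
        Filter.Tendsto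
          (fun t : ℝ => KWTheta.theta (KWTheta.c₀ m t) (KWTheta.c₁ m t) a b f τ)
          (nhdsWithin 0 (Set.Ioi 0))
          (nhds (∑' n : Fin m → ℤ × ℤ, KWTheta.signTerm b f τ (KWTheta.shift a n)))) ∧
    ((∀ t : ℝ, 0 < t → Summable fun n : Fin m → ℤ × ℤ =>
        KWTheta.thetaTerm (KWTheta.c₀ m t) (KWTheta.c₁ m t) (fun _ => (1 / 2, 1 / 2))
          (KWTheta.V m) τ (KWTheta.shift (fun _ => (0, 1 / 2)) n)) ∧
      (Summable fun n : Fin m → ℤ × ℤ => KWTheta.kwTerm τ n) ∧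
      Filter.Tendsto
        (fun t : ℝ => KWTheta.theta (KWTheta.c₀ m t) (KWTheta.c₁ m t)
          (fun _ => (0, 1 / 2)) (fun _ => (1 / 2, 1 / 2)) (KWTheta.V m) τ)
        (nhdsWithin 0 (Set.Ioi 0))
        (nhds ((4 * Complex.I) ^ m * (m.factorial : ℂ) *
          (∏ j ∈ Finset.Icc 1 m, ((2 * j - 1).factorial : ℂ)) ^ 2 * KWTheta.KW m τ))) := by
  open KWTheta in
  obtain ⟨d, hV⟩ := exists_isHomogeneous_V m
  have ha (j : Fin m) : (¬ ∃ n : ℤ, B₁ (1, 1) ((fun _ => (0, 1 / 2) : Vec m) j) = n) ∧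
      (¬ ∃ n : ℤ, B₁ (-1, 1) ((fun _ => (0, 1 / 2) : Vec m) j) = n) :=
    ⟨B₁_zero_half_not_int, B₁_zero_half_not_int⟩
  refine ⟨fun t ht j => ⟨mem_cone_of_sq_eq_one (one_pow 2) ht, mem_cone_of_sq_eq_one neg_one_sq ht⟩,
    fun d f hf a ha b => ⟨fun t ht => summable_thetaTerm τ ha b f ht, summable_signTerm τ hf ha b,
      tendsto_theta τ hf ha b⟩,
    fun t ht => summable_thetaTerm τ ha _ (V m) ht, ?_, ?_⟩
  · have hsign := summable_signTerm τ hV ha fun _ => (1 / 2, 1 / 2)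
    simp only [signTerm_V_shift] at hsign
    exact (summable_mul_left_iff (pow_ne_zero m Complex.I_ne_zero)).1 hsign
  · rw [← tsum_signTerm_V_shift]
    exact tendsto_theta τ hV ha _

theorem theorem5p7 (m : ℕ) (hm : 0 < m) (τ : UpperHalfPlane) :
    -- the vectors lie in the cone
    (∀ t : ℝ, 0 < t → ∀ j, KWTheta.c₀ m t j ∈ KWTheta.cone ∧ KWTheta.c₁ m t j ∈ KWTheta.cone) ∧
    -- the limit for a general spherical polynomial; all the series converge absolutely
    (∀ (d : ℕ) (f : KWTheta.Poly m), KWTheta.IsSpherical f d →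
      ∀ a : KWTheta.Vec m,
        (∀ j, (¬ ∃ n : ℤ, KWTheta.B₁ (1, 1) (a j) = n) ∧
          (¬ ∃ n : ℤ, KWTheta.B₁ (-1, 1) (a j) = n)) →
      ∀ b : KWTheta.Vec m,
        (∀ t : ℝ, 0 < t → Summable fun n : Fin m → ℤ × ℤ =>
          KWTheta.thetaTerm (KWTheta.c₀ m t) (KWTheta.c₁ m t) b f τ (KWTheta.shift a n)) ∧
        (Summable fun n : Fin m → ℤ × ℤ => KWTheta.signTerm b f τ (KWTheta.shift a n)) ∧
        Filter.Tendsto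
          (fun t : ℝ => KWTheta.theta (KWTheta.c₀ m t) (KWTheta.c₁ m t) a b f τ)
          (nhdsWithin 0 (Set.Ioi 0))
          (nhds (∑' n : Fin m → ℤ × ℤ, KWTheta.signTerm b f τ (KWTheta.shift a n)))) ∧
    -- the Kac-Wakimoto case; again all the series converge absolutely
    ((∀ t : ℝ, 0 < t → Summable fun n : Fin m → ℤ × ℤ =>
        KWTheta.thetaTerm (KWTheta.c₀ m t) (KWTheta.c₁ m t) (fun _ => (1 / 2, 1 / 2))
          (KWTheta.V m) τ (KWTheta.shift (fun _ => (0, 1 / 2)) n)) ∧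
      (Summable fun n : Fin m → ℤ × ℤ => KWTheta.kwTerm τ n) ∧
      Filter.Tendsto
        (fun t : ℝ => KWTheta.theta (KWTheta.c₀ m t) (KWTheta.c₁ m t)
          (fun _ => (0, 1 / 2)) (fun _ => (1 / 2, 1 / 2)) (KWTheta.V m) τ)
        (nhdsWithin 0 (Set.Ioi 0))
        (nhds ((4 * Complex.I) ^ m * (m.factorial : ℂ) *
          (∏ j ∈ Finset.Icc 1 m, ((2 * j - 1).factorial : ℂ)) ^ 2 * KWTheta.KW m τ))) := by
  obtain ⟨hcone, hlimit, hKW⟩ := theorem5p7_general m τ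
  exact ⟨hcone, fun d f hf => hlimit d f hf.1, hKW⟩
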